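/- A two-terminal graph $(G,s,t)$ is a simple graph $G$ together with two distinct vertices $s$ (the source) and $t$ (the sink). The serialization of a sequence $(G_1,s_1,t_1),\dots,(G_k,s_k,t_k)$, $k\ge 2$, of two-terminal graphs is the two-terminal graph with source $s_1$ and sink $t_k$ obtained from the disjoint union of the $G_i$ by identifying $t_i$ with $s_{i+1}$ for $i=1,\dots,k-1$. Their parallelization, defined when at most one $G_i$ contains the edge $s_it_i$, is obtained from the disjoint union by identifying all the sources $s_i$ into a single vertex, the new source, and all the sinks $t_i$ into a single vertex, the new sink. A two-terminal graph is series-parallel if it is a single edge joining its source and its sink, or is obtained from series-parallel graphs by a serialization or a parallelization. A straight-line embedding of a graph maps the vertices to distinct points of the plane and draws each edge as the straight segment between its end-vertices, so that no edge passes through a vertex other than its end-vertices and two distinct edges meet only in common end-vertices. The slope of a segment is the angle, taken modulo $\pi$, that it makes with the horizontal axis, and the planar slope number of a graph is the smallest number of distinct edge slopes in a straight-line embedding of it. **Theorem.** Let $(G,s,t)$ be a series-parallel graph in which every vertex has degree at most $3$. Then the planar slope number of $G$ is at most $3$. In fact, $G$ has a straight-line embedding in which the slope of every edge belongs to $\{0,\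 \pi/4,\ -\pi/4\}$ (modulo $\pi$). -/

import Mathlib

universe u

/-- A simple graph with two distinct prescribed vertices, its source `s` and its sink `t`. -/
structure TwoTerminalGraph where
  V : Type u
  graph : SimpleGraph V
  s : V
  t : V
  s_ne_t : s ≠ t

namespace TwoTerminalGraph

/-- The graph `G` is obtained from the disjoint union of the graphs `H i` by identifying vertices
along the equivalence relation generated by `r`; the map `f` sends each vertex of the disjoint
union to the vertex of `G` that it becomes. -/
structure IsIdentification {k : ℕ} (H : Fin k → TwoTerminalGraph.{u})
    (r : (Σ i, (H i).V) → (Σ i, (H i).V) → Prop) (G : TwoTerminalGraph.{u})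
    (f : (Σ i, (H i).V) → G.V) : Prop where
  surjective : Function.Surjective f
  eq_iff : ∀ a b, f a = f b ↔ Relation.EqvGen r a b
  adj_iff : ∀ u v, G.graph.Adj u v ↔
    ∃ i, ∃ x y : (H i).V, (H i).graph.Adj x y ∧ f ⟨i, x⟩ = u ∧ f ⟨i, y⟩ = v

/-- The sink of each graph of the sequence is identified with the source of the next one. -/
inductive SeriesRel {k : ℕ} (H : Fin k → TwoTerminalGraph.{u}) :
    (Σ i, (H i).V) → (Σ i, (H i).V) → Prop
  | glue (i j : Fin k) (hij : (i : ℕ) + 1 = j) : SeriesRel H ⟨i, (H i).t⟩ ⟨j, (H j).s⟩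

/-- All sources are identified with each other, and all sinks are identified with each other. -/
inductive ParallelRel {k : ℕ} (H : Fin k → TwoTerminalGraph.{u}) :
    (Σ i, (H i).V) → (Σ i, (H i).V) → Prop
  | source (i j : Fin k) : ParallelRel H ⟨i, (H i).s⟩ ⟨j, (H j).s⟩
  | sink (i j : Fin k) : ParallelRel H ⟨i, (H i).t⟩ ⟨j, (H j).t⟩

/-- `G` is (up to isomorphism) the serialization of the sequence `H 0, …, H (n + 1)`. -/
def IsSerialization {n : ℕ} (H : Fin (n + 2) → TwoTerminalGraph.{u})
    (G : TwoTerminalGraph.{u}) : Prop :=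
  ∃ f : (Σ i, (H i).V) → G.V, IsIdentification H (SeriesRel H) G f ∧
    f ⟨0, (H 0).s⟩ = G.s ∧ f ⟨Fin.last (n + 1), (H (Fin.last (n + 1))).t⟩ = G.t

/-- `G` is (up to isomorphism) the parallelization of the sequence `H 0, …, H (n + 1)`, in which
at most one graph contains the edge from its source to its sink. -/
def IsParallelization {n : ℕ} (H : Fin (n + 2) → TwoTerminalGraph.{u})
    (G : TwoTerminalGraph.{u}) : Prop :=
  (∀ i j, (H i).graph.Adj (H i).s (H i).t → (H j).graph.Adj (H j).s (H j).t → i = j) ∧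
  ∃ f : (Σ i, (H i).V) → G.V, IsIdentification H (ParallelRel H) G f ∧
    (∀ i, f ⟨i, (H i).s⟩ = G.s) ∧ ∀ i, f ⟨i, (H i).t⟩ = G.t

/-- Series-parallel graphs: single edges joining the two terminals, and everything obtained from
series-parallel graphs by serializations and parallelizations of at least two graphs. -/
inductive IsSeriesParallel : TwoTerminalGraph.{u} → Prop
  | edge (G : TwoTerminalGraph.{u}) (hadj : G.graph.Adj G.s G.t)
      (hV : ∀ v : G.V, v = G.s ∨ v = G.t) : IsSeriesParallel G
  | series {n : ℕ} (H : Fin (n + 2) → TwoTerminalGraph.{u}) (G : TwoTerminalGraph.{u})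
      (hH : ∀ i, IsSeriesParallel (H i)) (hG : IsSerialization H G) : IsSeriesParallel G
  | parallel {n : ℕ} (H : Fin (n + 2) → TwoTerminalGraph.{u}) (G : TwoTerminalGraph.{u})
      (hH : ∀ i, IsSeriesParallel (H i)) (hG : IsParallelization H G) : IsSeriesParallel G

end TwoTerminalGraph

/-- A straight-line embedding of `G` in the plane `ℂ`: the vertices are distinct points, the edge
`uv` is drawn as the segment between its end-vertices, an edge contains no vertex other than its
end-vertices, and two distinct edges meet only in common end-vertices. -/
structure IsStraightLineEmbedding {V : Type u} (G : SimpleGraph V) (φ : V → ℂ) : Prop where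
  injective : Function.Injective φ
  vertex_edge : ∀ u v w, G.Adj u v → φ w ∈ segment ℝ (φ u) (φ v) → w = u ∨ w = v
  edge_edge : ∀ u v x y, G.Adj u v → G.Adj x y → s(u, v) ≠ s(x, y) →
    segment ℝ (φ u) (φ v) ∩ segment ℝ (φ x) (φ y) ⊆ φ '' ({u, v} ∩ {x, y})

/-- The slope of the segment between two distinct points: the angle, modulo `π`, that it makes
with the horizontal axis. Each class of `AddCircle π = ℝ / πℤ` has exactly one representative
in `[0, π)`, and the slope does not depend on the order of the two points. -/
noncomputable def segmentSlope (p q : ℂ) : AddCircle Real.pi :=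
  ((Complex.arg (q - p) : ℝ) : AddCircle Real.pi)

/-- The set of slopes of the edges in a straight-line drawing of `G`. -/
def edgeSlopes {V : Type u} (G : SimpleGraph V) (φ : V → ℂ) : Set (AddCircle Real.pi) :=
  {α | ∃ u v, G.Adj u v ∧ segmentSlope (φ u) (φ v) = α}

/-- The planar slope number: the smallest number of distinct edge slopes in a straight-line
embedding of `G` (and `⊤` if `G` has no straight-line embedding). -/
noncomputable def planarSlopeNumber {V : Type u} (G : SimpleGraph V) : ℕ∞ :=
  ⨅ (φ : V → ℂ) (_ : IsStraightLineEmbedding G φ), (edgeSlopes G φ).encard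

/-! Work in coordinates where the three slopes are the directions of (1,0), (0,1) and (1,-1). The
triangle with vertices (0,0), (1,0), (0,1) has exactly these side directions, and affine maps that
respect them carry drawings to drawings. Drawings in regions that meet only at common terminals can
be united, so everything reduces to packing regions.

The core is `triangleDrawable`: if both terminals have degree at most 2, the graph fits in the
triangle with its terminals at the ends of the base. A series composition puts two half-size
triangles side by side. In a parallel composition all four terminal degrees are 1, so each part is
an edge, a path of two edges, or a smaller graph between two pendant edges; the degree bound 3
leaves the smaller graph with terminal degrees at most 2. One part stays near the base
(`drawable_lowTriangle`). The other has no edge joining its terminals and goes up one leg and down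
the opposite side (`drawable_roof`).

If just one terminal has degree 3, its position is left free and the drawing lies in a wedge with
the other terminal at the apex (`drawable_wedge`). If both have degree 3, either two opposite wedges
meet at their apices (series), or at most three triangular pieces are arranged around a triangle or
on both sides of a segment (parallel).

It remains to turn the given compositions of many graphs into binary ones, with neighbour counts
bounding the terminal degrees, and to map the three directions to the required slopes. -/

namespace SeriesParallelDrawing

open Set

/-! ### Drawings confined to a region -/

/-- The three directions in which edges are drawn, in coordinates with respect to a basis made of
two of them. -/
def IsDirection (d : ℝ × ℝ) : Prop := d.1 = 0 ∨ d.2 = 0 ∨ d.1 + d.2 = 0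

/-- `φ` restricts to a straight-line drawing of the graph `E` with vertex set `S` that lies in the
region `R` and uses only the three directions of `IsDirection`. -/
structure IsDrawing {V : Type u} (E : SimpleGraph V) (S : Set V) (R : Set (ℝ × ℝ))
    (φ : V → ℝ × ℝ) : Prop where
  injOn : InjOn φ S
  mapsTo : MapsTo φ S R
  mem_of_adj : ∀ u v, E.Adj u v → u ∈ S
  segment_subset : ∀ u v, E.Adj u v → segment ℝ (φ u) (φ v) ⊆ R
  vertex_edge : ∀ u v w, E.Adj u v → w ∈ S → φ w ∈ segment ℝ (φ u) (φ v) → w = u ∨ w = v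
  edge_edge : ∀ u v x y, E.Adj u v → E.Adj x y → s(u, v) ≠ s(x, y) →
    ∀ z ∈ segment ℝ (φ u) (φ v), z ∈ segment ℝ (φ x) (φ y) →
      ∃ w, (w = u ∨ w = v) ∧ (w = x ∨ w = y) ∧ φ w = z
  isDirection : ∀ u v, E.Adj u v → IsDirection (φ v - φ u)

namespace IsDrawing

variable {V : Type u} {E E₁ E₂ : SimpleGraph V} {S S₁ S₂ : Set V} {R R₁ R₂ : Set (ℝ × ℝ)}
  {φ φ₁ φ₂ : V → ℝ × ℝ}

lemma congr (h : IsDrawing E S R φ₁) (hφ : ∀ v ∈ S, φ₂ v = φ₁ v) : IsDrawing E S R φ₂ where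
  injOn := fun u hu v hv huv => h.injOn hu hv (by rwa [hφ u hu, hφ v hv] at huv)
  mapsTo := fun v hv => by rw [hφ v hv]; exact h.mapsTo hv
  mem_of_adj := h.mem_of_adj
  segment_subset := fun u v huv => by
    rw [hφ u (h.mem_of_adj u v huv), hφ v (h.mem_of_adj v u huv.symm)]
    exact h.segment_subset u v huv
  vertex_edge := fun u v w huv hw => by
    rw [hφ u (h.mem_of_adj u v huv), hφ v (h.mem_of_adj v u huv.symm), hφ w hw]
    exact h.vertex_edge u v w huv hw
  edge_edge := fun u v x y huv hxy hne z => by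
    rw [hφ u (h.mem_of_adj u v huv), hφ v (h.mem_of_adj v u huv.symm),
      hφ x (h.mem_of_adj x y hxy), hφ y (h.mem_of_adj y x hxy.symm)]
    intro hz hz'
    obtain ⟨w, h₁, h₂, h₃⟩ := h.edge_edge u v x y huv hxy hne z hz hz'
    refine ⟨w, h₁, h₂, ?_⟩
    rw [hφ w, h₃]
    rcases h₁ with rfl | rfl
    exacts [h.mem_of_adj _ _ huv, h.mem_of_adj _ _ huv.symm]
  isDirection := fun u v huv => by
    rw [hφ u (h.mem_of_adj u v huv), hφ v (h.mem_of_adj v u huv.symm)]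
    exact h.isDirection u v huv

/-- Any point common to both drawings lies in both regions, hence is a common vertex. An edge
through a vertex must end there, so a crossing between the two drawings is a common end-vertex. -/
lemma sup (h₁ : IsDrawing E₁ S₁ R₁ φ) (h₂ : IsDrawing E₂ S₂ R₂ φ)
    (hR : R₁ ∩ R₂ ⊆ φ '' (S₁ ∩ S₂)) : IsDrawing (E₁ ⊔ E₂) (S₁ ∪ S₂) (R₁ ∪ R₂) φ := by
  have key : ∀ u ∈ S₁, φ u ∈ R₂ → u ∈ S₂ := by
    intro u hu hu'
    obtain ⟨w, ⟨hw₁, hw₂⟩, hw⟩ := hR ⟨h₁.mapsTo hu, hu'⟩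
    rwa [← h₁.injOn hw₁ hu hw]
  have key' : ∀ u ∈ S₂, φ u ∈ R₁ → u ∈ S₁ := by
    intro u hu hu'
    obtain ⟨w, ⟨hw₁, hw₂⟩, hw⟩ := hR ⟨hu', h₂.mapsTo hu⟩
    rwa [← h₂.injOn hw₂ hu hw]
  have cross : ∀ u v x y, E₁.Adj u v → E₂.Adj x y → ∀ z ∈ segment ℝ (φ u) (φ v),
      z ∈ segment ℝ (φ x) (φ y) → ∃ w, (w = u ∨ w = v) ∧ (w = x ∨ w = y) ∧ φ w = z := by
    intro u v x y huv hxy z hz hz'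
    obtain ⟨w, ⟨hw₁, hw₂⟩, rfl⟩ := hR ⟨h₁.segment_subset u v huv hz, h₂.segment_subset x y hxy hz'⟩
    exact ⟨w, h₁.vertex_edge u v w huv hw₁ hz, h₂.vertex_edge x y w hxy hw₂ hz', rfl⟩
  refine ⟨?_, ?_, ?_, ?_, ?_, ?_, ?_⟩
  · rintro u (hu | hu) v (hv | hv) huv
    · exact h₁.injOn hu hv huv
    · exact h₂.injOn (key u hu (huv ▸ h₂.mapsTo hv)) hv huv
    · exact h₁.injOn (key' u hu (huv ▸ h₁.mapsTo hv)) hv huv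
    · exact h₂.injOn hu hv huv
  · rintro u (hu | hu)
    exacts [Or.inl (h₁.mapsTo hu), Or.inr (h₂.mapsTo hu)]
  · rintro u v (huv | huv)
    exacts [Or.inl (h₁.mem_of_adj u v huv), Or.inr (h₂.mem_of_adj u v huv)]
  · rintro u v (huv | huv)
    exacts [(h₁.segment_subset u v huv).trans subset_union_left,
      (h₂.segment_subset u v huv).trans subset_union_right]
  · rintro u v w (huv | huv) (hw | hw) hs
    · exact h₁.vertex_edge u v w huv hw hs
    · exact h₁.vertex_edge u v w huv (key' w hw (h₁.segment_subset u v huv hs)) hs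
    · exact h₂.vertex_edge u v w huv (key w hw (h₂.segment_subset u v huv hs)) hs
    · exact h₂.vertex_edge u v w huv hw hs
  · rintro u v x y (huv | huv) (hxy | hxy) hne z hz hz'
    · exact h₁.edge_edge u v x y huv hxy hne z hz hz'
    · exact cross u v x y huv hxy z hz hz'
    · obtain ⟨w, hw₁, hw₂, hw⟩ := cross x y u v hxy huv z hz' hz
      exact ⟨w, hw₂, hw₁, hw⟩
    · exact h₂.edge_edge u v x y huv hxy hne z hz hz'
  · rintro u v (huv | huv)
    exacts [h₁.isDirection u v huv, h₂.isDirection u v huv]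

lemma mono (h : IsDrawing E S R₁ φ) (hR : R₁ ⊆ R₂) : IsDrawing E S R₂ φ :=
  { h with
    mapsTo := h.mapsTo.mono_right hR
    segment_subset := fun u v huv => (h.segment_subset u v huv).trans hR }

lemma affine (h : IsDrawing E S R₁ φ) (F : (ℝ × ℝ) →ᵃ[ℝ] (ℝ × ℝ)) (hF : Function.Injective F)
    (hdir : ∀ d, IsDirection d → IsDirection (F.linear d)) (hR : MapsTo F R₁ R₂) :
    IsDrawing E S R₂ (F ∘ φ) where
  injOn := hF.comp_injOn h.injOn
  mapsTo := hR.comp h.mapsTo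
  mem_of_adj := h.mem_of_adj
  segment_subset := fun u v huv => by
    rw [Function.comp_apply, Function.comp_apply, ← image_segment]
    exact (hR.mono_left (h.segment_subset u v huv)).image_subset
  vertex_edge := fun u v w huv hw hs => by
    rw [Function.comp_apply, Function.comp_apply, ← image_segment] at hs
    exact h.vertex_edge u v w huv hw (hF.mem_set_image.1 hs)
  edge_edge := fun u v x y huv hxy hne z hz hz' => by
    rw [Function.comp_apply, Function.comp_apply, ← image_segment] at hz hz'
    obtain ⟨z, hz, rfl⟩ := hz
    obtain ⟨w, h₁, h₂, h₃⟩ := h.edge_edge u v x y huv hxy hne z hz (hF.mem_set_image.1 hz')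
    exact ⟨w, h₁, h₂, by rw [Function.comp_apply, h₃]⟩
  isDirection := fun u v huv => by
    have := hdir _ (h.isDirection u v huv)
    rwa [← vsub_eq_sub, F.linearMap_vsub] at this

end IsDrawing

/-- The graph `E` with vertex set `S` has a drawing in the region `R` that places the vertices
`a` and `b` at the points `p` and `q`. -/
def Drawable {V : Type u} (E : SimpleGraph V) (S : Set V) (R : Set (ℝ × ℝ)) (a b : V)
    (p q : ℝ × ℝ) : Prop :=
  ∃ φ, IsDrawing E S R φ ∧ a ∈ S ∧ b ∈ S ∧ φ a = p ∧ φ b = q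

/-! ### Affine maps respecting the three directions -/

/-- The affine map that sends the origin to `c` and the standard basis vectors to `u` and `v`. -/
def frameMap (c u v : ℝ × ℝ) : (ℝ × ℝ) →ᵃ[ℝ] (ℝ × ℝ) where
  toFun z := c + (z.1 • u + z.2 • v)
  linear := (LinearMap.fst ℝ ℝ ℝ).smulRight u + (LinearMap.snd ℝ ℝ ℝ).smulRight v
  map_vadd' p w := by
    ext <;> simp <;> ring

lemma frameMap_apply (c u v z : ℝ × ℝ) :
    frameMap c u v z = (c.1 + (z.1 * u.1 + z.2 * v.1), c.2 + (z.1 * u.2 + z.2 * v.2)) := rfl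

lemma frameMap_linear_apply (c u v z : ℝ × ℝ) :
    (frameMap c u v).linear z = (z.1 * u.1 + z.2 * v.1, z.1 * u.2 + z.2 * v.2) := rfl

lemma frameMap_injective {c u v : ℝ × ℝ} (h : u.1 * v.2 - u.2 * v.1 ≠ 0) :
    Function.Injective (frameMap c u v) := by
  intro z w hzw
  rw [frameMap_apply, frameMap_apply, Prod.mk.injEq] at hzw
  obtain ⟨h₁, h₂⟩ := hzw
  ext
  · apply mul_right_cancel₀ h
    linear_combination v.2 * h₁ - v.1 * h₂
  · apply mul_right_cancel₀ h
    linear_combination u.1 * h₂ - u.2 * h₁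

/-- Every direction is a multiple of (1,0), (0,1) or (1,-1), and these go to `u`, `v` and `u - v`.
-/
lemma isDirection_frameMap_linear {c u v : ℝ × ℝ} (hu : IsDirection u) (hv : IsDirection v)
    (huv : IsDirection (u - v)) {d : ℝ × ℝ} (hd : IsDirection d) :
    IsDirection ((frameMap c u v).linear d) := by
  have smul : ∀ (w : ℝ × ℝ) (r : ℝ), IsDirection w → IsDirection (r • w) := by
    rintro w r (h | h | h)
    · exact Or.inl (by simp [h])
    · exact Or.inr (Or.inl (by simp [h]))
    · exact Or.inr (Or.inr (by simp [← mul_add, h]))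
  rcases hd with h | h | h
  · convert smul v d.2 hv using 1
    rw [frameMap_linear_apply]; ext <;> simp [h]
  · convert smul u d.1 hu using 1
    rw [frameMap_linear_apply]; ext <;> simp [h]
  · convert smul (u - v) d.1 huv using 1
    rw [frameMap_linear_apply, eq_neg_of_add_eq_zero_right h]; ext <;> simp <;> ring

/-! ### Gluing drawings at prescribed terminals -/

namespace Drawable

variable {V : Type u} {E E₁ E₂ : SimpleGraph V} {S S₁ S₂ : Set V} {R R₁ R₂ : Set (ℝ × ℝ)}
  {a b c : V} {p q r : ℝ × ℝ}

lemma symm (h : Drawable E S R a b p q) : Drawable E S R b a q p := by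
  obtain ⟨φ, h, ha, hb, hp, hq⟩ := h
  exact ⟨φ, h, hb, ha, hq, hp⟩

lemma mono (h : Drawable E S R₁ a b p q) (hR : R₁ ⊆ R₂) : Drawable E S R₂ a b p q := by
  obtain ⟨φ, h, ha⟩ := h
  exact ⟨φ, h.mono hR, ha⟩

lemma frame (h : Drawable E S R₁ a b p q) (c u v : ℝ × ℝ) (hu : IsDirection u)
    (hv : IsDirection v) (huv : IsDirection (u - v)) (hdet : u.1 * v.2 - u.2 * v.1 ≠ 0)
    {p' q' : ℝ × ℝ} (hp' : frameMap c u v p = p') (hq' : frameMap c u v q = q')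
    (hR : ∀ z ∈ R₁, frameMap c u v z ∈ R₂) : Drawable E S R₂ a b p' q' := by
  obtain ⟨φ, h, ha, hb, rfl, rfl⟩ := h
  exact ⟨_, h.affine (frameMap c u v) (frameMap_injective hdet)
    (fun d => isDirection_frameMap_linear hu hv huv) hR, ha, hb, hp', hq'⟩

/-- The two placements agree on shared vertices, so they merge into one placement. The choice of
terminals in `ha` and `hb` serves both series and parallel gluing. -/
lemma sup {d : V} {p' q' : ℝ × ℝ} (h₁ : Drawable E₁ S₁ R₁ a b p q)
    (h₂ : Drawable E₂ S₂ R₂ c d p' q')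
    (hS : ∀ φ₁ φ₂ : V → ℝ × ℝ, φ₁ a = p → φ₁ b = q → φ₂ c = p' → φ₂ d = q' →
      (∀ v ∈ S₁ ∩ S₂, φ₂ v = φ₁ v) ∧ R₁ ∩ R₂ ⊆ φ₁ '' (S₁ ∩ S₂)) {a' b' : V}
    {p'' q'' : ℝ × ℝ}
    (ha : (a' = a ∧ p'' = p) ∨ (a' = c ∧ p'' = p'))
    (hb : (b' = b ∧ q'' = q) ∨ (b' = d ∧ q'' = q')) :
    Drawable (E₁ ⊔ E₂) (S₁ ∪ S₂) (R₁ ∪ R₂) a' b' p'' q'' := by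
  classical
  obtain ⟨φ₁, h₁, ha₁, hb₁, hp₁, hq₁⟩ := h₁
  obtain ⟨φ₂, h₂, ha₂, hb₂, hp₂, hq₂⟩ := h₂
  obtain ⟨hag, hR⟩ := hS φ₁ φ₂ hp₁ hq₁ hp₂ hq₂
  have e₁ : ∀ v ∈ S₁, (fun v => if v ∈ S₁ then φ₁ v else φ₂ v) v = φ₁ v :=
    fun v hv => if_pos hv
  have e₂ : ∀ v ∈ S₂, (fun v => if v ∈ S₁ then φ₁ v else φ₂ v) v = φ₂ v := by
    intro v hv
    by_cases hv₁ : v ∈ S₁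
    · exact (if_pos hv₁).trans (hag v ⟨hv₁, hv⟩).symm
    · exact if_neg hv₁
  refine ⟨_, (h₁.congr e₁).sup (h₂.congr e₂) ?_, ?_, ?_, ?_, ?_⟩
  · intro z hz
    obtain ⟨w, hw, rfl⟩ := hR hz
    exact ⟨w, hw, e₁ w hw.1⟩
  · rcases ha with ⟨rfl, rfl⟩ | ⟨rfl, rfl⟩
    exacts [Or.inl ha₁, Or.inr ha₂]
  · rcases hb with ⟨rfl, rfl⟩ | ⟨rfl, rfl⟩
    exacts [Or.inl hb₁, Or.inr hb₂]
  · rcases ha with ⟨rfl, rfl⟩ | ⟨rfl, rfl⟩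
    exacts [(e₁ _ ha₁).trans hp₁, (e₂ _ ha₂).trans hp₂]
  · rcases hb with ⟨rfl, rfl⟩ | ⟨rfl, rfl⟩
    exacts [(e₁ _ hb₁).trans hq₁, (e₂ _ hb₂).trans hq₂]

lemma left_mem (h : Drawable E S R a b p q) : a ∈ S := h.choose_spec.2.1

lemma right_mem (h : Drawable E S R a b p q) : b ∈ S := h.choose_spec.2.2.1

lemma series (h₁ : Drawable E₁ S₁ R₁ a b p q) (h₂ : Drawable E₂ S₂ R₂ b c q r)
    (hS : S₁ ∩ S₂ ⊆ {b}) (hR : R₁ ∩ R₂ ⊆ {q}) :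
    Drawable (E₁ ⊔ E₂) (S₁ ∪ S₂) (R₁ ∪ R₂) a c p r := by
  refine h₁.sup h₂ (fun φ₁ φ₂ _ hb hb' _ => ⟨fun v hv => ?_, fun z hz => ?_⟩)
    (Or.inl ⟨rfl, rfl⟩) (Or.inr ⟨rfl, rfl⟩)
  · rw [hS hv, hb, hb']
  · rw [hR hz, ← hb]
    exact mem_image_of_mem _ ⟨h₁.right_mem, h₂.left_mem⟩

lemma parallel (h₁ : Drawable E₁ S₁ R₁ a b p q) (h₂ : Drawable E₂ S₂ R₂ a b p q)
    (hS : S₁ ∩ S₂ ⊆ {a, b}) (hR : R₁ ∩ R₂ ⊆ {p, q}) :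
    Drawable (E₁ ⊔ E₂) (S₁ ∪ S₂) (R₁ ∪ R₂) a b p q := by
  refine h₁.sup h₂ (fun φ₁ φ₂ ha hb ha' hb' => ⟨fun v hv => ?_, fun z hz => ?_⟩)
    (Or.inl ⟨rfl, rfl⟩) (Or.inl ⟨rfl, rfl⟩)
  · rcases hS hv with rfl | rfl
    exacts [ha'.trans ha.symm, hb'.trans hb.symm]
  · rcases hR hz with rfl | rfl
    · exact ha ▸ mem_image_of_mem _ ⟨h₁.left_mem, h₂.left_mem⟩
    · exact hb ▸ mem_image_of_mem _ ⟨h₁.right_mem, h₂.right_mem⟩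

lemma edge (hab : a ≠ b) (hpq : p ≠ q) (hd : IsDirection (q - p))
    (hR : ∀ x : ℝ, 0 ≤ x → x ≤ 1 →
      (p.1 + x * (q.1 - p.1), p.2 + x * (q.2 - p.2)) ∈ R) :
    Drawable (SimpleGraph.edge a b) {a, b} R a b p q := by
  classical
  have hseg : segment ℝ p q ⊆ R := by
    rw [segment_eq_image']
    rintro _ ⟨x, ⟨hx₀, hx₁⟩, rfl⟩
    exact hR x hx₀ hx₁
  have hd' : IsDirection (p - q) := by
    simp only [IsDirection, Prod.fst_sub, Prod.snd_sub] at hd ⊢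
    rcases hd with h | h | h
    · exact Or.inl (by linarith)
    · exact Or.inr (Or.inl (by linarith))
    · exact Or.inr (Or.inr (by linarith))
  have key : ∀ φ : V → ℝ × ℝ, φ a = p → φ b = q →
      IsDrawing (SimpleGraph.edge a b) {a, b} R φ := by
    intro φ ha hb
    refine ⟨?_, ?_, ?_, ?_, ?_, ?_, ?_⟩
    · rintro u (rfl | rfl) v (rfl | rfl) huv
      · rfl
      · exact absurd (ha.symm.trans (huv.trans hb)) hpq
      · exact absurd (ha.symm.trans (huv.symm.trans hb)) hpq
      · rfl
    · rintro u (rfl | rfl)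
      · exact hseg (ha ▸ left_mem_segment ℝ _ _)
      · exact hseg (hb ▸ right_mem_segment ℝ _ _)
    · intro u v huv
      rw [SimpleGraph.edge_adj] at huv
      rcases huv.1 with h | h
      exacts [Or.inl h.1, Or.inr h.1]
    · intro u v huv
      rw [SimpleGraph.edge_adj] at huv
      rcases huv.1 with ⟨rfl, rfl⟩ | ⟨rfl, rfl⟩
      · rwa [ha, hb]
      · rwa [ha, hb, segment_symm]
    · intro u v w huv hw _
      rw [SimpleGraph.edge_adj] at huv
      rcases huv.1 with ⟨rfl, rfl⟩ | ⟨rfl, rfl⟩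
      exacts [hw, hw.symm]
    · intro u v x y huv hxy hne
      rw [SimpleGraph.adj_edge] at huv hxy
      exact absurd (huv.1.symm.trans hxy.1) hne
    · intro u v huv
      rw [SimpleGraph.edge_adj] at huv
      rcases huv.1 with ⟨rfl, rfl⟩ | ⟨rfl, rfl⟩
      · rwa [ha, hb]
      · rwa [ha, hb]
  refine ⟨fun v => if v = a then p else q, key _ (if_pos rfl) (if_neg hab.symm),
    Or.inl rfl, Or.inr rfl, if_pos rfl, if_neg hab.symm⟩

end Drawable

/-! ### Series-parallel graphs with recorded terminal degrees -/

/-- `SP k E S a b m n`: the graph `E` with vertex set `S` is series-parallel with terminals `a`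
and `b`, it is composed of `k` edges, the terminals have degrees `m` and `n`, and no two graphs
are put in series at a vertex of degree more than `3`. -/
inductive SP {V : Type u} : ℕ → SimpleGraph V → Set V → V → V → ℕ → ℕ → Prop
  | edge {a b : V} (hab : a ≠ b) : SP 1 (SimpleGraph.edge a b) {a, b} a b 1 1
  | series {k l : ℕ} {E F : SimpleGraph V} {S T : Set V} {a b c : V} {m n n' p : ℕ}
      (h₁ : SP k E S a b m n) (h₂ : SP l F T b c n' p) (hST : S ∩ T ⊆ {b}) (hn : n + n' ≤ 3) :
      SP (k + l) (E ⊔ F) (S ∪ T) a c m p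
  | parallel {k l : ℕ} {E F : SimpleGraph V} {S T : Set V} {a b : V} {m n m' n' : ℕ}
      (h₁ : SP k E S a b m n) (h₂ : SP l F T a b m' n') (hST : S ∩ T ⊆ {a, b})
      (hadj : ¬ (E.Adj a b ∧ F.Adj a b)) :
      SP (k + l) (E ⊔ F) (S ∪ T) a b (m + m') (n + n')

namespace SP

variable {V : Type u} {k : ℕ} {E : SimpleGraph V} {S : Set V} {a b : V} {m n : ℕ}

lemma pos (h : SP k E S a b m n) : 1 ≤ k ∧ 1 ≤ m ∧ 1 ≤ n := by
  induction h with
  | edge => simp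
  | series _ _ _ _ ih₁ ih₂ => omega
  | parallel _ _ _ _ ih₁ ih₂ => omega

lemma terminals_mem (h : SP k E S a b m n) : a ∈ S ∧ b ∈ S := by
  induction h with
  | edge => simp
  | series _ _ _ _ ih₁ ih₂ => exact ⟨Or.inl ih₁.1, Or.inr ih₂.2⟩
  | parallel _ _ _ _ ih₁ ih₂ => exact ⟨Or.inl ih₁.1, Or.inl ih₁.2⟩

lemma symm (h : SP k E S a b m n) : SP k E S b a n m := by
  induction h with
  | edge hab =>
    rw [SimpleGraph.edge_comm, pair_comm]
    exact .edge hab.symm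
  | series _ _ hST hn ih₁ ih₂ =>
    rw [sup_comm, union_comm, add_comm]
    exact .series ih₂ ih₁ (by rwa [inter_comm]) (by omega)
  | parallel _ _ hST hadj ih₁ ih₂ =>
    refine .parallel ih₁ ih₂ (by rwa [pair_comm]) ?_
    exact fun h => hadj ⟨h.1.symm, h.2.symm⟩

/-- A series-parallel graph whose first terminal has degree `1` is an edge, or an edge in series
with a series-parallel graph. -/
lemma head (h : SP k E S a b 1 n) :
    (n = 1 ∧ a ≠ b ∧ E = SimpleGraph.edge a b ∧ S = {a, b}) ∨
    ∃ (c : V) (l : ℕ) (F : SimpleGraph V) (T : Set V) (m : ℕ), a ≠ c ∧ SP l F T c b m n ∧ l < k ∧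
      m ≤ 2 ∧ {a, c} ∩ T ⊆ {c} ∧ E = SimpleGraph.edge a c ⊔ F ∧ S = {a, c} ∪ T := by
  -- The index 1 becomes a variable, as induction requires.
  obtain ⟨m, hm, h⟩ : ∃ m, m = 1 ∧ SP k E S a b m n := ⟨1, rfl, h⟩
  induction h with
  | edge hab => exact Or.inl ⟨rfl, hab, rfl, rfl⟩
  | @series k l E F S T a b c m n n' p h₁ h₂ hST hn ih₁ _ =>
    right
    have := h₁.pos
    have := h₂.pos
    rcases ih₁ (hm ▸ h₁) hm with ⟨-, hab, rfl, rfl⟩ | ⟨d, l', F', T', m', had, h', hl, hm', hS, rfl, rfl⟩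
    · exact ⟨b, l, F, T, n', hab, h₂, by omega, by omega, hST, rfl, rfl⟩
    · refine ⟨d, l' + l, F' ⊔ F, T' ∪ T, m', had, h'.series h₂ ?_ hn, by omega, hm', ?_,
        sup_assoc _ _ _, union_assoc _ _ _⟩
      · exact (inter_subset_inter_left _ subset_union_right).trans hST
      · rintro v ⟨hv, hv' | hv'⟩
        · exact hS ⟨hv, hv'⟩
        · have hvb : v = b := hST ⟨Or.inl hv, hv'⟩
          exact hS ⟨hv, hvb ▸ h'.terminals_mem.2⟩
  -- Both parts contribute at least 1 to the degree, so it cannot be 1.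
  | parallel h₁ h₂ _ _ _ _ =>
    have := h₁.pos
    have := h₂.pos
    omega

lemma tail (h : SP k E S a b m 1) :
    (m = 1 ∧ a ≠ b ∧ E = SimpleGraph.edge a b ∧ S = {a, b}) ∨
    ∃ (c : V) (l : ℕ) (F : SimpleGraph V) (T : Set V) (n : ℕ), c ≠ b ∧ SP l F T a c m n ∧ l < k ∧
      n ≤ 2 ∧ T ∩ {c, b} ⊆ {c} ∧ E = F ⊔ SimpleGraph.edge c b ∧ S = T ∪ {c, b} := by
  rcases h.symm.head with ⟨h₀, h₁, h₂, h₃⟩ | ⟨c, l, F, T, n, h₁, h₂, h₃, h₄, h₅, h₆, h₇⟩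
  · exact Or.inl ⟨h₀, h₁.symm, by rw [h₂, SimpleGraph.edge_comm], by rw [h₃, pair_comm]⟩
  · refine Or.inr ⟨c, l, F, T, n, h₁.symm, h₂.symm, h₃, h₄, ?_, ?_, ?_⟩
    · rwa [inter_comm, pair_comm]
    · rw [h₆, SimpleGraph.edge_comm, sup_comm]
    · rw [h₇, union_comm, pair_comm c b]

end SP

/-! ### Both terminals of degree at most 2 -/

/-- The triangle in which graphs with terminals of degree at most `2` are drawn. -/
def triangle : Set (ℝ × ℝ) := {z | 0 ≤ z.1 ∧ 0 ≤ z.2 ∧ z.1 + z.2 ≤ 1}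

/-- A part of the triangle that avoids the legs except in the terminals. -/
def lowTriangle : Set (ℝ × ℝ) := {z | 0 ≤ z.2 ∧ z.2 ≤ z.1 ∧ z.2 ≤ 1 - z.1 - z.2}

/-- A part of the triangle that avoids `lowTriangle` except in the terminals. -/
def roof : Set (ℝ × ℝ) :=
  {z | (0 ≤ z.1 ∧ 0 ≤ z.2 ∧ z.1 + z.2 ≤ 1) ∧ (z.1 = 0 ∨ z.1 + z.2 = 1 ∨ 1 / 2 ≤ z.2)}

/-- The graph has a drawing in the triangle, with its terminals at the ends of the base. -/
abbrev TriangleDrawable {V : Type u} (E : SimpleGraph V) (S : Set V) (a b : V) : Prop :=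
  Drawable E S triangle a b (0, 0) (1, 0)

lemma lowTriangle_subset : lowTriangle ⊆ triangle := by
  rintro ⟨x, y⟩ ⟨h₁, h₂, h₃⟩
  simp only at h₁ h₂ h₃
  exact ⟨by dsimp only; linarith, h₁, by dsimp only; linarith⟩

lemma roof_subset : roof ⊆ triangle := fun _ h => h.1

/-- The low triangle has apex (1/3, 1/3), below height 1/2, and meets the two other sides of the big
triangle only at the ends of the base. -/
lemma roof_inter_lowTriangle : roof ∩ lowTriangle ⊆ {(0, 0), (1, 0)} := by
  rintro ⟨x, y⟩ ⟨⟨⟨h₁, h₂, h₃⟩, h⟩, h₄, h₅, h₆⟩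
  simp only [mem_insert_iff, mem_singleton_iff, Prod.mk.injEq] at *
  rcases h with h | h | h
  · exact Or.inl ⟨h, by linarith⟩
  · exact Or.inr ⟨by linarith, by linarith⟩
  · linarith

section

variable {V : Type u} {k l : ℕ} {E F : SimpleGraph V} {S T : Set V} {a b c d : V} {m n m' n' : ℕ}

/-- The graph with terminals of degree `1` is an edge, a path with two edges, or a smaller
series-parallel graph with an edge attached at each terminal. -/
lemma SP.ends (h : SP k E S a b 1 1) :
    (a ≠ b ∧ E = SimpleGraph.edge a b ∧ S = {a, b}) ∨
    (∃ c, a ≠ c ∧ c ≠ b ∧ {a, c} ∩ {c, b} ⊆ ({c} : Set V) ∧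
      E = SimpleGraph.edge a c ⊔ SimpleGraph.edge c b ∧ S = {a, c} ∪ {c, b}) ∨
    ∃ (c d : V) (l : ℕ) (F : SimpleGraph V) (T : Set V) (m n : ℕ), a ≠ c ∧ d ≠ b ∧
      SP l F T c d m n ∧ l < k ∧ m ≤ 2 ∧ n ≤ 2 ∧ T ∩ {d, b} ⊆ {d} ∧ {a, c} ∩ (T ∪ {d, b}) ⊆ {c} ∧
      E = SimpleGraph.edge a c ⊔ (F ⊔ SimpleGraph.edge d b) ∧ S = {a, c} ∪ (T ∪ {d, b}) := by
  rcases h.head with h | ⟨c, l, F, T, m, hac, h', hl, hm, hT, rfl, rfl⟩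
  · exact Or.inl h.2
  rcases h'.tail with ⟨-, hcb, rfl, rfl⟩ | ⟨d, l', F, T, n, hdb, h'', hl', hn, hT', rfl, rfl⟩
  · exact Or.inr (Or.inl ⟨c, hac, hcb, hT, rfl, rfl⟩)
  · exact Or.inr (Or.inr ⟨c, d, l', F, T, m, n, hac, hdb, h'', by omega, hm, hn, hT', hT, rfl, rfl⟩)

/-- The pendant edges take the outer thirds of the base and the smaller graph a triangle over the
middle third, whose top vertex is the apex (1/3, 1/3) of the low triangle. The hypothesis `ih` is
the induction hypothesis of `triangleDrawable`. -/
lemma drawable_lowTriangle (h : SP k E S a b 1 1)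
    (ih : ∀ (l : ℕ) (F : SimpleGraph V) (T : Set V) (c d : V) (m n : ℕ), l < k → SP l F T c d m n →
      m ≤ 2 → n ≤ 2 → TriangleDrawable F T c d) :
    Drawable E S lowTriangle a b (0, 0) (1, 0) := by
  rcases h.ends with ⟨hab, rfl, rfl⟩ | ⟨c, hac, hcb, hS, rfl, rfl⟩ |
    ⟨c, d, l, F, T, m, n, hac, hdb, h', hl, hm, hn, hT, hT', rfl, rfl⟩
  · refine .edge hab (by simp) (by simp [IsDirection]) fun x hx₀ hx₁ => ?_
    refine ⟨?_, ?_, ?_⟩ <;> simp <;> linarith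
  · have h₁ : Drawable (SimpleGraph.edge a c) {a, c} {z | z.2 = 0 ∧ 0 ≤ z.1 ∧ z.1 ≤ 1 / 2} a c
        (0, 0) (1 / 2, 0) := by
      refine .edge hac (by simp) (by simp [IsDirection]) fun x hx₀ hx₁ => ?_
      refine ⟨?_, ?_, ?_⟩ <;> norm_num <;> linarith
    have h₂ : Drawable (SimpleGraph.edge c b) {c, b} {z | z.2 = 0 ∧ 1 / 2 ≤ z.1 ∧ z.1 ≤ 1} c b
        (1 / 2, 0) (1, 0) := by
      refine .edge hcb (by norm_num) (by simp [IsDirection]) fun x hx₀ hx₁ => ?_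
      refine ⟨?_, ?_, ?_⟩ <;> norm_num <;> linarith
    refine (h₁.series h₂ hS ?_).mono ?_
    · rintro ⟨x, y⟩ ⟨⟨h₁, h₂, h₃⟩, -, h₅, h₆⟩
      simp only [mem_singleton_iff, Prod.mk.injEq] at *
      exact ⟨by linarith, h₁⟩
    · rintro ⟨x, y⟩ (⟨h₁, h₂, h₃⟩ | ⟨h₁, h₂, h₃⟩) <;> simp only at h₁ h₂ h₃ <;>
        refine ⟨?_, ?_, ?_⟩ <;> dsimp only <;> linarith
  · have h₁ : Drawable (SimpleGraph.edge a c) {a, c} {z | z.2 = 0 ∧ 0 ≤ z.1 ∧ z.1 ≤ 1 / 3} a c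
        (0, 0) (1 / 3, 0) := by
      refine .edge hac (by simp) (by simp [IsDirection]) fun x hx₀ hx₁ => ?_
      refine ⟨?_, ?_, ?_⟩ <;> norm_num <;> linarith
    have h₂ : Drawable F T {z | 0 ≤ z.2 ∧ 1 / 3 ≤ z.1 ∧ z.1 + z.2 ≤ 2 / 3} c d
        (1 / 3, 0) (2 / 3, 0) := by
      refine (ih l F T c d m n hl h' hm hn).frame (1 / 3, 0) (1 / 3, 0) (0, 1 / 3)
        (by simp [IsDirection]) (by simp [IsDirection]) (by simp [IsDirection])
        (by norm_num) (by norm_num [frameMap_apply]) (by norm_num [frameMap_apply]) ?_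
      rintro ⟨x, y⟩ ⟨h₁, h₂, h₃⟩
      simp only at h₁ h₂ h₃
      simp only [frameMap_apply]
      refine ⟨?_, ?_, ?_⟩ <;> dsimp only <;> linarith
    have h₃ : Drawable (SimpleGraph.edge d b) {d, b} {z | z.2 = 0 ∧ 2 / 3 ≤ z.1 ∧ z.1 ≤ 1} d b
        (2 / 3, 0) (1, 0) := by
      refine .edge hdb (by norm_num) (by simp [IsDirection]) fun x hx₀ hx₁ => ?_
      refine ⟨?_, ?_, ?_⟩ <;> norm_num <;> linarith
    refine (h₁.series (h₂.series h₃ hT ?_) hT' ?_).mono ?_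
    · rintro ⟨x, y⟩ ⟨⟨h₁, h₂, h₃⟩, h₄, h₅, h₆⟩
      simp only [mem_singleton_iff, Prod.mk.injEq] at *
      exact ⟨by linarith, h₄⟩
    · rintro ⟨x, y⟩ ⟨⟨h₁, h₂, h₃⟩, ⟨h₄, h₅, h₆⟩ | ⟨h₄, h₅, h₆⟩⟩ <;>
        simp only [mem_singleton_iff, Prod.mk.injEq] at * <;>
        exact ⟨by linarith, h₁⟩
    · rintro ⟨x, y⟩ (⟨h₁, h₂, h₃⟩ | ⟨h₁, h₂, h₃⟩ | ⟨h₁, h₂, h₃⟩) <;> simp only at h₁ h₂ h₃ <;>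
        refine ⟨?_, ?_, ?_⟩ <;> dsimp only <;> linarith

/-- The pendant edges run along the two sides above the base, and the smaller graph fills the
half-size triangle at the top. A single edge has no such drawing, hence `hadj`. -/
lemma drawable_roof (h : SP k E S a b 1 1) (hadj : ¬ E.Adj a b)
    (ih : ∀ (l : ℕ) (F : SimpleGraph V) (T : Set V) (c d : V) (m n : ℕ), l < k → SP l F T c d m n →
      m ≤ 2 → n ≤ 2 → TriangleDrawable F T c d) :
    Drawable E S roof a b (0, 0) (1, 0) := by
  rcases h.ends with ⟨hab, rfl, rfl⟩ | ⟨c, hac, hcb, hS, rfl, rfl⟩ |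
    ⟨c, d, l, F, T, m, n, hac, hdb, h', hl, hm, hn, hT, hT', rfl, rfl⟩
  · exact absurd ((SimpleGraph.edge_adj _ _ _ _).2 ⟨Or.inl ⟨rfl, rfl⟩, hab⟩) hadj
  · have h₁ : Drawable (SimpleGraph.edge a c) {a, c} {z | z.1 = 0 ∧ 0 ≤ z.2 ∧ z.2 ≤ 1} a c
        (0, 0) (0, 1) := by
      refine .edge hac (by simp) (by simp [IsDirection]) fun x hx₀ hx₁ => ?_
      refine ⟨?_, ?_, ?_⟩ <;> norm_num <;> linarith
    have h₂ : Drawable (SimpleGraph.edge c b) {c, b} {z | z.1 + z.2 = 1 ∧ 0 ≤ z.1 ∧ 0 ≤ z.2} c b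
        (0, 1) (1, 0) := by
      refine .edge hcb (by norm_num) (by simp [IsDirection]) fun x hx₀ hx₁ => ?_
      refine ⟨?_, ?_, ?_⟩ <;> norm_num <;> linarith
    refine (h₁.series h₂ hS ?_).mono ?_
    · rintro ⟨x, y⟩ ⟨⟨h₁, h₂, h₃⟩, h₄, h₅, h₆⟩
      simp only [mem_singleton_iff, Prod.mk.injEq] at *
      exact ⟨h₁, by linarith⟩
    · rintro ⟨x, y⟩ (⟨h₁, h₂, h₃⟩ | ⟨h₁, h₂, h₃⟩) <;> simp only at h₁ h₂ h₃
      · refine ⟨⟨?_, ?_, ?_⟩, Or.inl h₁⟩ <;> dsimp only <;> linarith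
      · refine ⟨⟨?_, ?_, ?_⟩, Or.inr (Or.inl h₁)⟩ <;> dsimp only <;> linarith
  · have h₁ : Drawable (SimpleGraph.edge a c) {a, c} {z | z.1 = 0 ∧ 0 ≤ z.2 ∧ z.2 ≤ 1 / 2} a c
        (0, 0) (0, 1 / 2) := by
      refine .edge hac (by simp) (by simp [IsDirection]) fun x hx₀ hx₁ => ?_
      refine ⟨?_, ?_, ?_⟩ <;> norm_num <;> linarith
    have h₂ : Drawable F T {z | 0 ≤ z.1 ∧ 1 / 2 ≤ z.2 ∧ z.1 + z.2 ≤ 1} c d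
        (0, 1 / 2) (1 / 2, 1 / 2) := by
      refine (ih l F T c d m n hl h' hm hn).frame (0, 1 / 2) (1 / 2, 0) (0, 1 / 2)
        (by simp [IsDirection]) (by simp [IsDirection]) (by simp [IsDirection])
        (by norm_num) (by norm_num [frameMap_apply]) (by norm_num [frameMap_apply]) ?_
      rintro ⟨x, y⟩ ⟨h₁, h₂, h₃⟩
      simp only at h₁ h₂ h₃
      simp only [frameMap_apply]
      refine ⟨?_, ?_, ?_⟩ <;> dsimp only <;> linarith
    have h₃ : Drawable (SimpleGraph.edge d b) {d, b} {z | z.1 + z.2 = 1 ∧ 1 / 2 ≤ z.1 ∧ 0 ≤ z.2} d b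
        (1 / 2, 1 / 2) (1, 0) := by
      refine .edge hdb (by norm_num) (by norm_num [IsDirection]) fun x hx₀ hx₁ => ?_
      refine ⟨?_, ?_, ?_⟩ <;> norm_num <;> linarith
    refine (h₁.series (h₂.series h₃ hT ?_) hT' ?_).mono ?_
    · rintro ⟨x, y⟩ ⟨⟨h₁, h₂, h₃⟩, h₄, h₅, h₆⟩
      simp only [mem_singleton_iff, Prod.mk.injEq] at *
      exact ⟨by linarith, by linarith⟩
    · rintro ⟨x, y⟩ ⟨⟨h₁, h₂, h₃⟩, ⟨h₄, h₅, h₆⟩ | ⟨h₄, h₅, h₆⟩⟩ <;>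
        simp only [mem_singleton_iff, Prod.mk.injEq] at * <;>
        exact ⟨h₁, by linarith⟩
    · rintro ⟨x, y⟩ (⟨h₁, h₂, h₃⟩ | ⟨h₁, h₂, h₃⟩ | ⟨h₁, h₂, h₃⟩) <;> simp only at h₁ h₂ h₃
      · refine ⟨⟨?_, ?_, ?_⟩, Or.inl h₁⟩ <;> dsimp only <;> linarith
      · refine ⟨⟨?_, ?_, ?_⟩, Or.inr (Or.inr h₂)⟩ <;> dsimp only <;> linarith
      · refine ⟨⟨?_, ?_, ?_⟩, Or.inr (Or.inl h₁)⟩ <;> dsimp only <;> linarith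

lemma triangleDrawable_series (h₁ : TriangleDrawable E S a b) (h₂ : TriangleDrawable F T b c)
    (hST : S ∩ T ⊆ {b}) : TriangleDrawable (E ⊔ F) (S ∪ T) a c := by
  have h₁ : Drawable E S {z | 0 ≤ z.1 ∧ 0 ≤ z.2 ∧ z.1 + z.2 ≤ 1 / 2} a b (0, 0) (1 / 2, 0) := by
    refine h₁.frame (0, 0) (1 / 2, 0) (0, 1 / 2)
      (by simp [IsDirection]) (by simp [IsDirection]) (by simp [IsDirection])
      (by norm_num) (by norm_num [frameMap_apply]) (by norm_num [frameMap_apply]) ?_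
    rintro ⟨x, y⟩ ⟨h₁, h₂, h₃⟩
    simp only at h₁ h₂ h₃
    simp only [frameMap_apply]
    refine ⟨?_, ?_, ?_⟩ <;> dsimp only <;> linarith
  have h₂ : Drawable F T {z | 1 / 2 ≤ z.1 ∧ 0 ≤ z.2 ∧ z.1 + z.2 ≤ 1} b c (1 / 2, 0) (1, 0) := by
    refine h₂.frame (1 / 2, 0) (1 / 2, 0) (0, 1 / 2)
      (by simp [IsDirection]) (by simp [IsDirection]) (by simp [IsDirection])
      (by norm_num) (by norm_num [frameMap_apply]) (by norm_num [frameMap_apply]) ?_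
    rintro ⟨x, y⟩ ⟨h₁, h₂, h₃⟩
    simp only at h₁ h₂ h₃
    simp only [frameMap_apply]
    refine ⟨?_, ?_, ?_⟩ <;> dsimp only <;> linarith
  refine (h₁.series h₂ hST ?_).mono ?_
  · rintro ⟨x, y⟩ ⟨⟨h₁, h₂, h₃⟩, h₄, h₅, h₆⟩
    simp only [mem_singleton_iff, Prod.mk.injEq] at *
    exact ⟨by linarith, by linarith⟩
  · rintro ⟨x, y⟩ (⟨h₁, h₂, h₃⟩ | ⟨h₁, h₂, h₃⟩) <;> simp only at h₁ h₂ h₃ <;>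
      refine ⟨?_, ?_, ?_⟩ <;> dsimp only <;> linarith

lemma triangleDrawable (h : SP k E S a b m n) (hm : m ≤ 2) (hn : n ≤ 2) :
    TriangleDrawable E S a b := by
  induction k using Nat.strong_induction_on generalizing E S a b m n with
  | _ k ih =>
  have ih' : ∀ (l : ℕ) (F : SimpleGraph V) (T : Set V) (c d : V) (m n : ℕ), l < k →
      SP l F T c d m n → m ≤ 2 → n ≤ 2 → TriangleDrawable F T c d :=
    fun l F T c d m n hl h hm hn => ih l hl h hm hn
  cases h with
  | edge hab => exact (drawable_lowTriangle (.edge hab) ih').mono lowTriangle_subset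
  | series h₁ h₂ hST hnn =>
    have := h₁.pos
    have := h₂.pos
    exact triangleDrawable_series (ih _ (by omega) h₁ hm (by omega))
      (ih _ (by omega) h₂ (by omega) hn) hST
  | @parallel k l E F S T _ _ m n m' n' h₁ h₂ hST hadj =>
    -- Each part contributes at least 1 to terminal degrees that are at most 2, so all four are 1.
    have := h₁.pos
    have := h₂.pos
    obtain ⟨rfl, rfl, rfl, rfl⟩ : m = 1 ∧ n = 1 ∧ m' = 1 ∧ n' = 1 := by omega
    by_cases hE : E.Adj a b
    · have hF : ¬ F.Adj a b := fun h => hadj ⟨hE, h⟩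
      rw [sup_comm, union_comm]
      refine ((drawable_roof h₂ hF fun l F T c d m n hl => ih' l F T c d m n (by omega)).parallel
        (drawable_lowTriangle h₁ fun l F T c d m n hl => ih' l F T c d m n (by omega))
        (by rwa [inter_comm]) roof_inter_lowTriangle).mono
        (union_subset roof_subset lowTriangle_subset)
    · exact ((drawable_roof h₁ hE fun l F T c d m n hl => ih' l F T c d m n (by omega)).parallel
        (drawable_lowTriangle h₂ fun l F T c d m n hl => ih' l F T c d m n (by omega))
        hST roof_inter_lowTriangle).mono (union_subset roof_subset lowTriangle_subset)

end

/-! ### One terminal of degree 3 -/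

/-- The region in which graphs with a first terminal of degree `3` are drawn. -/
def wedge : Set (ℝ × ℝ) := {z | z.1 ≤ 0 ∧ z.1 + z.2 ≤ 0}

section

variable {V : Type u} {k l : ℕ} {E F : SimpleGraph V} {S T : Set V} {a b c d : V} {m n m' n' : ℕ}

/-- Removing the last edge of the first part leaves terminal degrees at most 2. That remainder
occupies a triangle on the segment from (-1,0) to (-1,1), the removed edge descends to the apex, and
the second part hangs below the segment from (-1,0) to the apex. -/
lemma drawable_wedge_parallel (h₁ : SP k E S a b 2 1) (h₂ : SP l F T a b 1 1)
    (hST : S ∩ T ⊆ {a, b}) : ∃ p, Drawable (E ⊔ F) (S ∪ T) wedge a b p (0, 0) := by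
  rcases h₁.tail with ⟨hm, -⟩ | ⟨c, l', F', T', n', hcb, h, -, hn', hT, rfl, rfl⟩
  · exact absurd hm (by norm_num)
  have hX : Drawable F' T' {z | z.1 ≤ -1 ∧ z.2 ≤ 1 ∧ -1 ≤ z.1 + z.2} a c (-1, 0) (-1, 1) := by
    refine (triangleDrawable h le_rfl hn').frame (-1, 0) (0, 1) (-1, 1)
      (by simp [IsDirection]) (by simp [IsDirection]) (by simp [IsDirection])
      (by norm_num) (by norm_num [frameMap_apply]) (by norm_num [frameMap_apply]) ?_
    rintro ⟨x, y⟩ ⟨h₁, h₂, h₃⟩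
    simp only at h₁ h₂ h₃
    simp only [frameMap_apply]
    refine ⟨?_, ?_, ?_⟩ <;> dsimp only <;> linarith
  have he : Drawable (SimpleGraph.edge c b) {c, b} {z | z.1 + z.2 = 0 ∧ -1 ≤ z.1 ∧ z.1 ≤ 0} c b
      (-1, 1) (0, 0) := by
    refine .edge hcb (by norm_num) (by norm_num [IsDirection]) fun x hx₀ hx₁ => ?_
    refine ⟨?_, ?_, ?_⟩ <;> norm_num <;> linarith
  have hB : Drawable F T {z | z.1 ≤ 0 ∧ z.2 ≤ 0 ∧ -1 ≤ z.1 + z.2} a b (-1, 0) (0, 0) := by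
    refine (triangleDrawable h₂ (by norm_num) (by norm_num)).frame (-1, 0) (1, 0) (1, -1)
      (by simp [IsDirection]) (by simp [IsDirection]) (by simp [IsDirection])
      (by norm_num) (by norm_num [frameMap_apply]) (by norm_num [frameMap_apply]) ?_
    rintro ⟨x, y⟩ ⟨h₁, h₂, h₃⟩
    simp only at h₁ h₂ h₃
    simp only [frameMap_apply]
    refine ⟨?_, ?_, ?_⟩ <;> dsimp only <;> linarith
  refine ⟨(-1, 0), ((hX.series he hT ?_).parallel hB hST ?_).mono ?_⟩
  · rintro ⟨x, y⟩ ⟨⟨h₁, h₂, h₃⟩, h₄, h₅, h₆⟩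
    simp only [mem_singleton_iff, Prod.mk.injEq] at *
    exact ⟨by linarith, by linarith⟩
  · rintro ⟨x, y⟩ ⟨⟨h₁, h₂, h₃⟩ | ⟨h₁, h₂, h₃⟩, h₄, h₅, h₆⟩ <;>
      simp only [mem_insert_iff, mem_singleton_iff, Prod.mk.injEq] at *
    · exact Or.inl ⟨by linarith, by linarith⟩
    · exact Or.inr ⟨by linarith, by linarith⟩
  · rintro ⟨x, y⟩ ((⟨h₁, h₂, h₃⟩ | ⟨h₁, h₂, h₃⟩) | ⟨h₁, h₂, h₃⟩) <;> simp only at h₁ h₂ h₃ <;>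
      refine ⟨?_, ?_⟩ <;> dsimp only <;> linarith

/-- The wedge moved by (-1,0) leaves room for a triangle between the old apex and the new one. -/
lemma drawable_wedge_series {p : ℝ × ℝ} (h₁ : Drawable E S wedge a b p (0, 0))
    (h₂ : TriangleDrawable F T b c) (hST : S ∩ T ⊆ {b}) :
    ∃ p, Drawable (E ⊔ F) (S ∪ T) wedge a c p (0, 0) := by
  have h₁ : Drawable E S {z | z.1 ≤ -1 ∧ z.1 + z.2 ≤ -1} a b (p.1 - 1, p.2) (-1, 0) := by
    refine h₁.frame (-1, 0) (1, 0) (0, 1)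
      (by simp [IsDirection]) (by simp [IsDirection]) (by simp [IsDirection])
      (by norm_num) (by simp [frameMap_apply]; ring) (by norm_num [frameMap_apply]) ?_
    rintro ⟨x, y⟩ ⟨h₁, h₂⟩
    simp only at h₁ h₂
    simp only [frameMap_apply]
    refine ⟨?_, ?_⟩ <;> dsimp only <;> linarith
  have h₂ : Drawable F T {z | -1 ≤ z.1 ∧ 0 ≤ z.2 ∧ z.1 + z.2 ≤ 0} b c (-1, 0) (0, 0) := by
    refine h₂.frame (-1, 0) (1, 0) (0, 1)
      (by simp [IsDirection]) (by simp [IsDirection]) (by simp [IsDirection])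
      (by norm_num) (by norm_num [frameMap_apply]) (by norm_num [frameMap_apply]) ?_
    rintro ⟨x, y⟩ ⟨h₁, h₂, h₃⟩
    simp only at h₁ h₂ h₃
    simp only [frameMap_apply]
    refine ⟨?_, ?_, ?_⟩ <;> dsimp only <;> linarith
  refine ⟨_, (h₁.series h₂ hST ?_).mono ?_⟩
  · rintro ⟨x, y⟩ ⟨⟨h₁, h₂⟩, h₄, h₅, h₆⟩
    simp only [mem_singleton_iff, Prod.mk.injEq] at *
    exact ⟨by linarith, by linarith⟩
  · rintro ⟨x, y⟩ (⟨h₁, h₂⟩ | ⟨h₁, h₂, h₃⟩)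
    · simp only at h₁ h₂
      refine ⟨?_, ?_⟩ <;> dsimp only <;> linarith
    · simp only at h₁ h₂ h₃
      refine ⟨?_, ?_⟩ <;> dsimp only <;> linarith

lemma drawable_wedge (h : SP k E S a b m n) (hm : m = 3) (hn : n ≤ 2) :
    ∃ p, Drawable E S wedge a b p (0, 0) := by
  induction h with
  | edge => omega
  | series h₁ h₂ hST hnn ih₁ _ =>
    have := h₁.pos
    have := h₂.pos
    obtain ⟨p, hp⟩ := ih₁ hm (by omega)
    exact drawable_wedge_series hp (triangleDrawable h₂ (by omega) hn) hST
  | @parallel k l E F S T a b m n m' n' h₁ h₂ hST hadj =>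
    have := h₁.pos
    have := h₂.pos
    obtain ⟨rfl, rfl⟩ : n = 1 ∧ n' = 1 := by omega
    obtain ⟨rfl, rfl⟩ | ⟨rfl, rfl⟩ : (m = 2 ∧ m' = 1) ∨ (m = 1 ∧ m' = 2) := by omega
    · exact drawable_wedge_parallel h₁ h₂ hST
    · rw [sup_comm, union_comm]
      exact drawable_wedge_parallel h₂ h₁ (by rwa [inter_comm])

/-! ### Both terminals of degree 3 -/

/-- A point reflection sends the wedge to the opposite one, which meets it only at the apex. -/
lemma exists_drawable_series {p p' : ℝ × ℝ} (h₁ : Drawable E S wedge a b p (0, 0))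
    (h₂ : Drawable F T wedge c b p' (0, 0)) (hST : S ∩ T ⊆ {b}) :
    ∃ R p q, Drawable (E ⊔ F) (S ∪ T) R a c p q := by
  have h₂ : Drawable F T {z | 0 ≤ z.1 ∧ 0 ≤ z.1 + z.2} c b (-p'.1, -p'.2) (0, 0) := by
    refine h₂.frame (0, 0) (-1, 0) (0, -1)
      (by simp [IsDirection]) (by simp [IsDirection]) (by simp [IsDirection])
      (by norm_num) (by simp [frameMap_apply]) (by simp [frameMap_apply]) ?_
    rintro ⟨x, y⟩ ⟨h₁, h₂⟩
    simp only at h₁ h₂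
    simp only [frameMap_apply]
    refine ⟨?_, ?_⟩ <;> dsimp only <;> linarith
  refine ⟨_, _, _, h₁.series h₂.symm hST ?_⟩
  rintro ⟨x, y⟩ ⟨⟨h₁, h₂⟩, h₄, h₅⟩
  simp only [mem_singleton_iff, Prod.mk.injEq] at *
  exact ⟨by linarith, by linarith⟩

/-- The three graphs lie in triangles erected outwards on the sides of the triangle (0,0), (0,1),
(1,0), so they meet only at its corners. -/
lemma exists_drawable_threeSides {E' : SimpleGraph V} {S' : Set V}
    (h₁ : TriangleDrawable E S a c) (h₂ : TriangleDrawable E' S' c b)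
    (h₃ : TriangleDrawable F T a b) (hS : S ∩ S' ⊆ {c}) (hST : (S ∪ S') ∩ T ⊆ {a, b}) :
    ∃ R p q, Drawable (E ⊔ E' ⊔ F) (S ∪ S' ∪ T) R a b p q := by
  have h₁ : Drawable E S {z | z.1 ≤ 0 ∧ z.2 ≤ 1 ∧ 0 ≤ z.1 + z.2} a c (0, 0) (0, 1) := by
    refine h₁.frame (0, 0) (0, 1) (-1, 1)
      (by simp [IsDirection]) (by simp [IsDirection]) (by simp [IsDirection])
      (by norm_num) (by norm_num [frameMap_apply]) (by norm_num [frameMap_apply]) ?_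
    rintro ⟨x, y⟩ ⟨h₁, h₂, h₃⟩
    simp only at h₁ h₂ h₃
    simp only [frameMap_apply]
    refine ⟨?_, ?_, ?_⟩ <;> dsimp only <;> linarith
  have h₂ : Drawable E' S' {z | z.1 ≤ 1 ∧ z.2 ≤ 1 ∧ 1 ≤ z.1 + z.2} c b (0, 1) (1, 0) := by
    refine h₂.frame (0, 1) (1, -1) (1, 0)
      (by simp [IsDirection]) (by simp [IsDirection]) (by simp [IsDirection])
      (by norm_num) (by norm_num [frameMap_apply]) (by norm_num [frameMap_apply]) ?_
    rintro ⟨x, y⟩ ⟨h₁, h₂, h₃⟩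
    simp only at h₁ h₂ h₃
    simp only [frameMap_apply]
    refine ⟨?_, ?_, ?_⟩ <;> dsimp only <;> linarith
  have h₃ : Drawable F T {z | z.1 ≤ 1 ∧ z.2 ≤ 0 ∧ 0 ≤ z.1 + z.2} a b (0, 0) (1, 0) := by
    refine h₃.frame (0, 0) (1, 0) (1, -1)
      (by simp [IsDirection]) (by simp [IsDirection]) (by simp [IsDirection])
      (by norm_num) (by norm_num [frameMap_apply]) (by norm_num [frameMap_apply]) ?_
    rintro ⟨x, y⟩ ⟨h₁, h₂, h₃⟩
    simp only at h₁ h₂ h₃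
    simp only [frameMap_apply]
    refine ⟨?_, ?_, ?_⟩ <;> dsimp only <;> linarith
  refine ⟨_, _, _, (h₁.series h₂ hS ?_).parallel h₃ hST ?_⟩
  · rintro ⟨x, y⟩ ⟨⟨h₁, h₂, h₃⟩, h₄, h₅, h₆⟩
    simp only [mem_singleton_iff, Prod.mk.injEq] at *
    exact ⟨by linarith, by linarith⟩
  · rintro ⟨x, y⟩ ⟨⟨h₁, h₂, h₃⟩ | ⟨h₁, h₂, h₃⟩, h₄, h₅, h₆⟩ <;>
      simp only [mem_insert_iff, mem_singleton_iff, Prod.mk.injEq] at *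
    · exact Or.inl ⟨by linarith, by linarith⟩
    · exact Or.inr ⟨by linarith, by linarith⟩

/-- The roof is flipped below the base and, having no edge along it, meets the triangle above only
in the terminals. -/
lemma exists_drawable_roof_below (h₁ : TriangleDrawable E S a b)
    (h₂ : Drawable F T roof a b (0, 0) (1, 0)) (hST : S ∩ T ⊆ {a, b}) :
    ∃ R p q, Drawable (E ⊔ F) (S ∪ T) R a b p q := by
  have h₂ : Drawable F T {z | (z.1 ≤ 1 ∧ z.2 ≤ 0 ∧ 0 ≤ z.1 + z.2) ∧
      (z.1 + z.2 = 0 ∨ z.1 = 1 ∨ z.2 ≤ -1 / 2)} a b (0, 0) (1, 0) := by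
    refine h₂.frame (0, 0) (1, 0) (1, -1)
      (by simp [IsDirection]) (by simp [IsDirection]) (by simp [IsDirection])
      (by norm_num) (by norm_num [frameMap_apply]) (by norm_num [frameMap_apply]) ?_
    rintro ⟨x, y⟩ ⟨⟨h₁, h₂, h₃⟩, h⟩
    simp only at h₁ h₂ h₃ h
    simp only [frameMap_apply]
    refine ⟨⟨?_, ?_, ?_⟩, h.imp ?_ (Or.imp ?_ ?_)⟩ <;> dsimp only <;> intros <;> linarith
  refine ⟨_, _, _, h₁.parallel h₂ hST ?_⟩
  rintro ⟨x, y⟩ ⟨⟨h₁, h₂, h₃⟩, ⟨h₄, h₅, h₆⟩, h⟩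
  simp only [mem_insert_iff, mem_singleton_iff, Prod.mk.injEq] at *
  rcases h with h | h | h
  · exact Or.inl ⟨by linarith, by linarith⟩
  · exact Or.inr ⟨by linarith, by linarith⟩
  · linarith

/-- If `E` is a series composition, its two parts and `F` take the three sides of a triangle. If it
is a parallel one, there are three parallel parts with all terminal degrees 1; one without the edge
`ab` becomes the roof below, and the other two share the triangle above. -/
lemma exists_drawable_parallel (h₁ : SP k E S a b 2 n) (h₂ : SP l F T a b 1 n')
    (hST : S ∩ T ⊆ {a, b}) (hadj : ¬ (E.Adj a b ∧ F.Adj a b)) (hn : n + n' ≤ 3) :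
    ∃ R p q, Drawable (E ⊔ F) (S ∪ T) R a b p q := by
  have hroof : ∀ {k : ℕ} {E : SimpleGraph V} {S : Set V}, SP k E S a b 1 1 → ¬ E.Adj a b →
      Drawable E S roof a b (0, 0) (1, 0) := fun h hadj =>
    drawable_roof h hadj fun _ _ _ _ _ _ _ _ h hm hn => triangleDrawable h hm hn
  have := h₁.pos
  have h₂pos := h₂.pos
  have h₁' := h₁
  generalize hm : 2 = m at h₁'
  cases h₁' with
  | edge => omega
  | series h h' hS hnn =>
    have := h.pos
    have := h'.pos
    exact exists_drawable_threeSides (triangleDrawable h (by omega) (by omega))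
      (triangleDrawable h' (by omega) (by omega)) (triangleDrawable h₂ (by omega) (by omega)) hS hST
  | @parallel k₁ k₂ E₁ E₂ S₁ S₂ _ _ m₁ n₁ m₂ n₂ h h' hS hadj' =>
    have := h.pos
    have := h'.pos
    obtain ⟨rfl, rfl, rfl, rfl, rfl⟩ : m₁ = 1 ∧ m₂ = 1 ∧ n₁ = 1 ∧ n₂ = 1 ∧ n' = 1 := by omega
    by_cases hF : F.Adj a b
    · have hE₁ : ¬ E₁.Adj a b := fun h => hadj ⟨Or.inl h, hF⟩
      have hE₂ : ¬ E₂.Adj a b := fun h => hadj ⟨Or.inr h, hF⟩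
      rw [sup_right_comm, union_right_comm]
      -- Here `F` contains the edge `ab`, so it cannot be the roof; it is paired with `E₁`, and `E₂`
      -- goes below.
      refine exists_drawable_roof_below (triangleDrawable (h.parallel h₂ ?_ fun h => hE₁ h.1)
        le_rfl le_rfl) (hroof h' hE₂) ?_
      · exact (inter_subset_inter_left _ subset_union_left).trans hST
      · rintro v ⟨hv | hv, hv'⟩
        exacts [hS ⟨hv, hv'⟩, hST ⟨Or.inr hv', hv⟩]
    · exact exists_drawable_roof_below (triangleDrawable h₁ le_rfl le_rfl) (hroof h₂ hF) hST

/-- Every series-parallel graph of maximum degree at most `3` has a drawing with three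
directions. -/
theorem SP.exists_drawable (h : SP k E S a b m n) (hm : m ≤ 3) (hn : n ≤ 3) :
    ∃ R p q, Drawable E S R a b p q := by
  rcases Nat.lt_or_ge m 3 with hm' | hm' <;> rcases Nat.lt_or_ge n 3 with hn' | hn'
  · exact ⟨_, _, _, triangleDrawable h (by omega) (by omega)⟩
  · obtain ⟨p, hp⟩ := drawable_wedge h.symm (by omega) (by omega)
    exact ⟨_, _, _, hp.symm⟩
  · obtain ⟨p, hp⟩ := drawable_wedge h (by omega) (by omega)
    exact ⟨_, _, _, hp⟩
  cases h with
  | edge => omega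
  | series h₁ h₂ hST hnn =>
    have := h₁.pos
    have := h₂.pos
    obtain ⟨p, hp⟩ := drawable_wedge h₁ (by omega) (by omega)
    obtain ⟨p', hp'⟩ := drawable_wedge h₂.symm (by omega) (by omega)
    exact exists_drawable_series hp hp' hST
  | @parallel k l E F S T _ _ m n m' n' h₁ h₂ hST hadj =>
    have := h₁.pos
    have := h₂.pos
    obtain ⟨rfl, rfl⟩ | ⟨rfl, rfl⟩ : (m = 2 ∧ m' = 1) ∨ (m = 1 ∧ m' = 2) := by omega
    · exact exists_drawable_parallel h₁ h₂ hST hadj hn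
    · rw [sup_comm, union_comm]
      exact exists_drawable_parallel h₂ h₁ (by rwa [inter_comm]) (by rwa [and_comm]) (by omega)

end

/-! ### Binary compositions inside one vertex type -/

/-- The graph `E` with vertex set `S` is built from single edges by binary serializations and
parallelizations, and has terminals `a` and `b`. -/
inductive Composed {V : Type u} : SimpleGraph V → Set V → V → V → Prop
  | edge {a b : V} (hab : a ≠ b) : Composed (SimpleGraph.edge a b) {a, b} a b
  | series {E F : SimpleGraph V} {S T : Set V} {a b c : V} (h₁ : Composed E S a b)
      (h₂ : Composed F T b c) (hST : S ∩ T ⊆ {b}) : Composed (E ⊔ F) (S ∪ T) a c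
  | parallel {E F : SimpleGraph V} {S T : Set V} {a b : V} (h₁ : Composed E S a b)
      (h₂ : Composed F T a b) (hST : S ∩ T ⊆ {a, b}) (hadj : ¬ (E.Adj a b ∧ F.Adj a b)) :
      Composed (E ⊔ F) (S ∪ T) a b

namespace Composed

variable {V W : Type u} {E F : SimpleGraph V} {S T : Set V} {a b : V}

lemma mem_of_adj (h : Composed E S a b) {u v : V} (huv : E.Adj u v) : u ∈ S := by
  induction h with
  | edge =>
    rw [SimpleGraph.edge_adj] at huv
    exact huv.1.imp And.left And.left
  | series _ _ _ ih₁ ih₂ => exact huv.imp ih₁ ih₂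
  | parallel _ _ _ _ ih₁ ih₂ => exact huv.imp ih₁ ih₂

lemma map (h : Composed E S a b) (f : V ↪ W) : Composed (E.map f) (f '' S) (f a) (f b) := by
  have map_sup : ∀ E F : SimpleGraph V, (E ⊔ F).map f = E.map f ⊔ F.map f := by
    intro E F
    ext u v
    simp only [SimpleGraph.sup_adj, SimpleGraph.map_adj, ← exists_or, or_and_right]
  induction h with
  | @edge a b hab =>
    have : (SimpleGraph.edge a b).map f = SimpleGraph.edge (f a) (f b) := by
      ext u v
      simp only [SimpleGraph.map_adj, SimpleGraph.edge_adj]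
      constructor
      · rintro ⟨x, y, ⟨h, hne⟩, rfl, rfl⟩
        simpa using ⟨h, hne⟩
      · rintro ⟨⟨rfl, rfl⟩ | ⟨rfl, rfl⟩, hne⟩
        · exact ⟨_, _, ⟨Or.inl ⟨rfl, rfl⟩, hab⟩, rfl, rfl⟩
        · exact ⟨_, _, ⟨Or.inr ⟨rfl, rfl⟩, hab.symm⟩, rfl, rfl⟩
    rw [this, image_pair]
    exact .edge (f.injective.ne hab)
  | series _ _ hST ih₁ ih₂ =>
    rw [map_sup, image_union]
    refine .series ih₁ ih₂ ?_
    rw [← image_inter f.injective, ← image_singleton]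
    exact image_mono hST
  | parallel _ _ hST hadj ih₁ ih₂ =>
    rw [map_sup, image_union]
    refine .parallel ih₁ ih₂ ?_ ?_
    · rw [← image_inter f.injective, ← image_pair]
      exact image_mono hST
    · rwa [SimpleGraph.map_adj_apply, SimpleGraph.map_adj_apply]

lemma iSup_series {n : ℕ} (E : Fin (n + 1) → SimpleGraph V) (S : Fin (n + 1) → Set V)
    (s t : Fin (n + 1) → V) (h : ∀ i, Composed (E i) (S i) (s i) (t i))
    (hst : ∀ i : Fin n, t i.castSucc = s i.succ)
    (hS : ∀ i j, i < j → ∀ v ∈ S i, v ∈ S j → (i : ℕ) + 1 = j ∧ v = t i) :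
    Composed (⨆ i, E i) (⋃ i, S i) (s 0) (t (Fin.last n)) := by
  induction n with
  | zero => simpa [iSup_unique, ← iSup_eq_iUnion] using h 0
  | succ n ih =>
    have hE : ⨆ i, E i = (⨆ i : Fin (n + 1), E i.castSucc) ⊔ E (Fin.last _) := by
      ext u v
      simp [Fin.exists_fin_succ']
    have hS' : ⋃ i, S i = (⋃ i : Fin (n + 1), S i.castSucc) ∪ S (Fin.last _) := by
      ext v
      simp [Fin.exists_fin_succ']
    rw [hE, hS']
    refine .series (b := t (Fin.last n).castSucc) ?_ ?_ ?_
    · exact ih (fun i => E i.castSucc) (fun i => S i.castSucc) (fun i => s i.castSucc)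
        (fun i => t i.castSucc) (fun i => h _) (fun i => hst i.castSucc)
        (fun i j hij => hS i.castSucc j.castSucc hij)
    · rw [hst]
      exact h (Fin.last _)
    · rintro v ⟨hv, hv'⟩
      obtain ⟨i, hi⟩ := mem_iUnion.1 hv
      obtain ⟨h₁, h₂⟩ := hS _ _ (Fin.castSucc_lt_last i) v hi hv'
      have : i = Fin.last n := Fin.ext (by simpa using h₁)
      rw [h₂, this]
      rfl

lemma iSup_parallel {n : ℕ} (E : Fin (n + 1) → SimpleGraph V) (S : Fin (n + 1) → Set V)
    (h : ∀ i, Composed (E i) (S i) a b) (hS : ∀ i j, i ≠ j → S i ∩ S j ⊆ {a, b})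
    (hadj : ∀ i j, (E i).Adj a b → (E j).Adj a b → i = j) :
    Composed (⨆ i, E i) (⋃ i, S i) a b := by
  induction n with
  | zero => simpa [iSup_unique, ← iSup_eq_iUnion] using h 0
  | succ n ih =>
    have hE : ⨆ i, E i = (⨆ i : Fin (n + 1), E i.castSucc) ⊔ E (Fin.last _) := by
      ext u v
      simp [Fin.exists_fin_succ']
    have hS' : ⋃ i, S i = (⋃ i : Fin (n + 1), S i.castSucc) ∪ S (Fin.last _) := by
      ext v
      simp [Fin.exists_fin_succ']
    rw [hE, hS']
    refine .parallel ?_ (h _) ?_ ?_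
    · exact ih (fun i => E i.castSucc) (fun i => S i.castSucc) (fun i => h _)
        (fun i j hij => hS _ _ (by simpa using hij))
        (fun i j hi hj => Fin.castSucc_injective _ (hadj _ _ hi hj))
    · rintro v ⟨hv, hv'⟩
      obtain ⟨i, hi⟩ := mem_iUnion.1 hv
      exact hS _ _ (Fin.castSucc_lt_last i).ne ⟨hi, hv'⟩
    · rintro ⟨h₁, h₂⟩
      obtain ⟨i, hi⟩ := SimpleGraph.iSup_adj.1 h₁
      exact (Fin.castSucc_lt_last i).ne (hadj _ _ hi h₂)

/-- Neighbour sets of the two parts at a glued vertex are disjoint: in series no other vertex is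
shared, and in parallel only the opposite terminal is, which at most one part joins by an edge.
Hence recorded degrees add up without exceeding true ones. -/
lemma exists_sp (h : Composed E S a b) (hdeg : ∀ v, (E.neighborSet v).encard ≤ 3) :
    ∃ k m n : ℕ, SP k E S a b m n ∧ m ≤ (E.neighborSet a).encard ∧
      n ≤ (E.neighborSet b).encard := by
  have neighborSet_sup : ∀ (E F : SimpleGraph V) (v : V),
      (E ⊔ F).neighborSet v = E.neighborSet v ∪ F.neighborSet v := fun E F v => rfl
  induction h with
  | @edge a b hab =>
    refine ⟨1, 1, 1, .edge hab, ?_, ?_⟩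
    · rw [Nat.cast_one, one_le_encard_iff_nonempty]
      exact ⟨b, (SimpleGraph.edge_adj _ _ _ _).2 ⟨Or.inl ⟨rfl, rfl⟩, hab⟩⟩
    · rw [Nat.cast_one, one_le_encard_iff_nonempty]
      exact ⟨a, (SimpleGraph.edge_adj _ _ _ _).2 ⟨Or.inr ⟨rfl, rfl⟩, hab.symm⟩⟩
  | @series E F S T a b c h₁ h₂ hST ih₁ ih₂ =>
    obtain ⟨k, m, n, h, hm, hn⟩ := ih₁ fun v => (encard_le_encard subset_union_left).trans (hdeg v)
    obtain ⟨k', m', n', h', hm', hn'⟩ :=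
      ih₂ fun v => (encard_le_encard subset_union_right).trans (hdeg v)
    have hdisj : Disjoint (E.neighborSet b) (F.neighborSet b) := by
      rw [Set.disjoint_left]
      intro v hv hv'
      have hvb : v = b := hST ⟨h₁.mem_of_adj hv.symm, h₂.mem_of_adj hv'.symm⟩
      exact hv.ne hvb.symm
    have hsum := hdeg b
    rw [neighborSet_sup, encard_union_eq hdisj] at hsum
    refine ⟨_, m, n', h.series h' hST ?_, hm.trans (encard_le_encard subset_union_left),
      hn'.trans (encard_le_encard subset_union_right)⟩
    exact_mod_cast (add_le_add hn hm').trans hsum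
  | @parallel E F S T a b h₁ h₂ hST hadj ih₁ ih₂ =>
    obtain ⟨k, m, n, h, hm, hn⟩ := ih₁ fun v => (encard_le_encard subset_union_left).trans (hdeg v)
    obtain ⟨k', m', n', h', hm', hn'⟩ :=
      ih₂ fun v => (encard_le_encard subset_union_right).trans (hdeg v)
    have hdisj : Disjoint (E.neighborSet a) (F.neighborSet a) := by
      rw [Set.disjoint_left]
      intro v hv hv'
      rcases hST ⟨h₁.mem_of_adj hv.symm, h₂.mem_of_adj hv'.symm⟩ with rfl | rfl
      exacts [hv.ne rfl, hadj ⟨hv, hv'⟩]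
    have hdisj' : Disjoint (E.neighborSet b) (F.neighborSet b) := by
      rw [Set.disjoint_left]
      intro v hv hv'
      rcases hST ⟨h₁.mem_of_adj hv.symm, h₂.mem_of_adj hv'.symm⟩ with rfl | rfl
      exacts [hadj ⟨hv.symm, hv'.symm⟩, hv.ne rfl]
    refine ⟨_, _, _, h.parallel h' hST hadj, ?_, ?_⟩
    · rw [neighborSet_sup, encard_union_eq hdisj, Nat.cast_add]
      exact add_le_add hm hm'
    · rw [neighborSet_sup, encard_union_eq hdisj', Nat.cast_add]
      exact add_le_add hn hn'

end Composed

open TwoTerminalGraph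

/-! ### From identifications of many graphs to binary compositions -/

/-- Applied to the retractions onto a single part, this detects which vertices an identification
keeps apart. -/
lemma eq_of_eqvGen {α β : Type*} {r : α → α → Prop} {g : α → β} (hg : ∀ a b, r a b → g a = g b)
    {a b : α} (h : Relation.EqvGen r a b) : g a = g b := by
  induction h with
  | rel a b h => exact hg a b h
  | refl => rfl
  | symm _ _ _ ih => exact ih.symm
  | trans _ _ _ _ _ ih₁ ih₂ => exact ih₁.trans ih₂

section

variable {k : ℕ} (H : Fin k → TwoTerminalGraph.{u})

open Classical in
/-- Collapses the graphs before the `i`-th one to its source and those after it to its sink. -/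
noncomputable def seriesRetraction (i : Fin k) (a : Σ i, (H i).V) : (H i).V :=
  if h : a.1 = i then h ▸ a.2 else if a.1 < i then (H i).s else (H i).t

lemma seriesRetraction_self (i : Fin k) (x : (H i).V) : seriesRetraction H i ⟨i, x⟩ = x :=
  dif_pos rfl

lemma seriesRetraction_of_lt {i j : Fin k} (hij : j < i) (x : (H j).V) :
    seriesRetraction H i ⟨j, x⟩ = (H i).s :=
  (dif_neg hij.ne).trans (if_pos hij)

lemma seriesRetraction_of_gt {i j : Fin k} (hij : i < j) (x : (H j).V) :
    seriesRetraction H i ⟨j, x⟩ = (H i).t :=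
  (dif_neg hij.ne').trans (if_neg hij.not_gt)

lemma seriesRetraction_eq (i : Fin k) (a b : Σ i, (H i).V) (h : SeriesRel H a b) :
    seriesRetraction H i a = seriesRetraction H i b := by
  obtain ⟨j, l, hjl⟩ := h
  rcases lt_trichotomy j i with hj | rfl | hj
  · rw [seriesRetraction_of_lt H hj]
    obtain rfl | hl : l = i ∨ l < i := by
      rw [Fin.ext_iff, Fin.lt_def]; rw [Fin.lt_def] at hj; omega
    · rw [seriesRetraction_self]
    · rw [seriesRetraction_of_lt H hl]
  · rw [seriesRetraction_self, seriesRetraction_of_gt H (by rw [Fin.lt_def]; omega)]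
  · rw [seriesRetraction_of_gt H hj,
      seriesRetraction_of_gt H (by rw [Fin.lt_def] at *; omega)]

open Classical in
/-- Collapses the graphs other than the `i`-th one to its terminals. -/
noncomputable def parallelRetraction (i : Fin k) (a : Σ i, (H i).V) : (H i).V :=
  if h : a.1 = i then h ▸ a.2 else if a.2 = (H a.1).s then (H i).s else (H i).t

lemma parallelRetraction_self (i : Fin k) (x : (H i).V) : parallelRetraction H i ⟨i, x⟩ = x :=
  dif_pos rfl

lemma parallelRetraction_mem {i j : Fin k} (hij : j ≠ i) (x : (H j).V) :
    parallelRetraction H i ⟨j, x⟩ = (H i).s ∨ parallelRetraction H i ⟨j, x⟩ = (H i).t := by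
  rw [parallelRetraction, dif_neg hij]
  split_ifs
  exacts [Or.inl rfl, Or.inr rfl]

lemma parallelRetraction_source (i j : Fin k) :
    parallelRetraction H i ⟨j, (H j).s⟩ = (H i).s := by
  by_cases hij : j = i
  · subst hij
    exact parallelRetraction_self H _ _
  · exact (dif_neg hij).trans (if_pos rfl)

lemma parallelRetraction_sink (i j : Fin k) :
    parallelRetraction H i ⟨j, (H j).t⟩ = (H i).t := by
  by_cases hij : j = i
  · subst hij
    exact parallelRetraction_self H _ _
  · exact (dif_neg hij).trans (if_neg (H j).s_ne_t.symm)

lemma parallelRetraction_eq (i : Fin k) (a b : Σ i, (H i).V) (h : ParallelRel H a b) :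
    parallelRetraction H i a = parallelRetraction H i b := by
  obtain ⟨j, l⟩ | ⟨j, l⟩ := h
  · rw [parallelRetraction_source, parallelRetraction_source]
  · rw [parallelRetraction_sink, parallelRetraction_sink]

end

section

variable {n : ℕ} {H : Fin (n + 2) → TwoTerminalGraph.{u}} {G : TwoTerminalGraph.{u}}

/-- Each retraction is constant on identified vertices and the identity on its own part. So every
part embeds in `G`, and the images overlap only where consecutive parts are glued. -/
lemma composed_of_isSerialization (hH : ∀ i, Composed (H i).graph univ (H i).s (H i).t)
    (hG : IsSerialization H G) : Composed G.graph univ G.s G.t := by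
  obtain ⟨f, hf, hs, ht⟩ := hG
  have hret : ∀ i {a b}, f a = f b → seriesRetraction H i a = seriesRetraction H i b :=
    fun i a b hab => eq_of_eqvGen (seriesRetraction_eq H i) ((hf.eq_iff a b).1 hab)
  let g : ∀ i, (H i).V ↪ G.V := fun i => ⟨fun x => f ⟨i, x⟩, fun x y hxy => by
    simpa only [seriesRetraction_self] using hret i hxy⟩
  have key := Composed.iSup_series (fun i => (H i).graph.map (g i)) (fun i => g i '' univ)
    (fun i => g i (H i).s) (fun i => g i (H i).t) (fun i => (hH i).map (g i)) ?_ ?_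
  · convert key using 1
    · ext u v
      rw [hf.adj_iff, SimpleGraph.iSup_adj]
      simp only [SimpleGraph.map_adj]
      rfl
    · refine (eq_univ_of_forall fun v => ?_).symm
      obtain ⟨⟨i, x⟩, rfl⟩ := hf.surjective v
      exact mem_iUnion.2 ⟨i, x, mem_univ _, rfl⟩
    · exact hs.symm
    · exact ht.symm
  · intro i
    exact (hf.eq_iff _ _).2 (.rel _ _ (.glue _ _ (by simp)))
  · rintro i j hij _ ⟨x, -, rfl⟩ ⟨y, -, hxy⟩
    have hx := hret i hxy
    rw [seriesRetraction_self, seriesRetraction_of_gt H hij] at hx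
    refine ⟨?_, by rw [hx]⟩
    by_contra hne
    rw [Fin.lt_def] at hij
    -- If `j` is beyond `i + 1`, the retraction onto part `i + 1` sends the shared vertex both to
    -- its source and to its sink.
    have hl : (i : ℕ) + 1 < n + 2 := by omega
    have hl' := hret ⟨i + 1, hl⟩ hxy
    rw [seriesRetraction_of_gt H (Fin.lt_def.2 (by dsimp only; omega)),
      seriesRetraction_of_lt H (Fin.lt_def.2 (by dsimp only; omega))] at hl'
    exact (H _).s_ne_t hl'.symm

lemma composed_of_isParallelization (hH : ∀ i, Composed (H i).graph univ (H i).s (H i).t)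
    (hG : IsParallelization H G) : Composed G.graph univ G.s G.t := by
  obtain ⟨hedge, f, hf, hs, ht⟩ := hG
  have hret : ∀ i {a b}, f a = f b → parallelRetraction H i a = parallelRetraction H i b :=
    fun i a b hab => eq_of_eqvGen (parallelRetraction_eq H i) ((hf.eq_iff a b).1 hab)
  let g : ∀ i, (H i).V ↪ G.V := fun i => ⟨fun x => f ⟨i, x⟩, fun x y hxy => by
    simpa only [parallelRetraction_self] using hret i hxy⟩
  have hadj : ∀ i, ((H i).graph.map (g i)).Adj G.s G.t → (H i).graph.Adj (H i).s (H i).t := by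
    intro i hi
    rw [← hs i, ← ht i] at hi
    exact SimpleGraph.map_adj_apply.1 hi
  have key := Composed.iSup_parallel (a := G.s) (b := G.t) (fun i => (H i).graph.map (g i))
    (fun i => g i '' univ) (fun i => ?_) ?_
    (fun i j hi hj => hedge i j (hadj i hi) (hadj j hj))
  · convert key using 1
    · ext u v
      rw [hf.adj_iff, SimpleGraph.iSup_adj]
      simp only [SimpleGraph.map_adj]
      rfl
    · refine (eq_univ_of_forall fun v => ?_).symm
      obtain ⟨⟨i, x⟩, rfl⟩ := hf.surjective v
      exact mem_iUnion.2 ⟨i, x, mem_univ _, rfl⟩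
  · have := (hH i).map (g i)
    rwa [show g i (H i).s = G.s from hs i, show g i (H i).t = G.t from ht i] at this
  · rintro i j hij _ ⟨⟨x, -, rfl⟩, ⟨y, -, hxy⟩⟩
    have hx := hret i hxy
    rw [parallelRetraction_self] at hx
    rcases parallelRetraction_mem H hij.symm y with h | h
    · exact Or.inl (by rw [← hs i, ← h, hx]; rfl)
    · exact Or.inr (by rw [mem_singleton_iff, ← ht i, ← h, hx]; rfl)

end

lemma composed_of_isSeriesParallel {G : TwoTerminalGraph.{u}} (hG : G.IsSeriesParallel) :
    Composed G.graph univ G.s G.t := by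
  induction hG with
  | edge G hadj hV =>
    convert Composed.edge G.s_ne_t using 1
    · ext u v
      rw [SimpleGraph.edge_adj]
      constructor
      · intro h
        rcases hV u with rfl | rfl <;> rcases hV v with rfl | rfl
        · exact absurd rfl h.ne
        · exact ⟨Or.inl ⟨rfl, rfl⟩, h.ne⟩
        · exact ⟨Or.inr ⟨rfl, rfl⟩, h.ne⟩
        · exact absurd rfl h.ne
      · rintro ⟨⟨rfl, rfl⟩ | ⟨rfl, rfl⟩, -⟩
        exacts [hadj, hadj.symm]
    · exact (eq_univ_of_forall hV).symm
  | series H G _ hG ih => exact composed_of_isSerialization ih hG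
  | parallel H G _ hG ih => exact composed_of_isParallelization ih hG

/-! ### Slopes in the complex plane -/

/-- The linear map that takes the two coordinate directions to the slopes `π / 4` and `-π / 4`. -/
noncomputable def toComplex : (ℝ × ℝ) →ₗ[ℝ] ℂ :=
  (LinearMap.fst ℝ ℝ ℝ).smulRight (1 + Complex.I) +
    (LinearMap.snd ℝ ℝ ℝ).smulRight (-1 + Complex.I)

lemma toComplex_apply (z : ℝ × ℝ) :
    toComplex z = (z.1 : ℂ) * (1 + Complex.I) + (z.2 : ℂ) * (-1 + Complex.I) := rfl

lemma toComplex_injective : Function.Injective toComplex := by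
  intro z w h
  rw [toComplex_apply, toComplex_apply, Complex.ext_iff] at h
  simp at h
  ext <;> linarith [h.1, h.2]

lemma image_segment_toComplex (p q : ℝ × ℝ) :
    toComplex '' segment ℝ p q = segment ℝ (toComplex p) (toComplex q) :=
  image_segment ℝ toComplex.toAffineMap p q

/-- A negative factor turns the angle by π, which vanishes in the quotient. The range of `θ` keeps
both `θ` and `θ + π` in the range of `Complex.arg`. -/
lemma arg_real_mul_cos_add_sin {r θ : ℝ} (hr : r ≠ 0) (hθ : θ ∈ Ioc (-Real.pi) 0) :
    ((Complex.arg (r * (Complex.cos θ + Complex.sin θ * Complex.I)) : ℝ) : AddCircle Real.pi) =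
      (θ : AddCircle Real.pi) := by
  have hpi := Real.pi_pos
  rcases hr.lt_or_gt with hr | hr
  · have : (r : ℂ) * (Complex.cos θ + Complex.sin θ * Complex.I) =
        ((-r : ℝ) : ℂ) * (Complex.cos ((θ + Real.pi : ℝ) : ℂ) +
          Complex.sin ((θ + Real.pi : ℝ) : ℂ) * Complex.I) := by
      push_cast
      rw [Complex.cos_add_pi, Complex.sin_add_pi]
      ring
    rw [this, Complex.arg_mul_cos_add_sin_mul_I (neg_pos.2 hr)
      ⟨by linarith [hθ.1], by linarith [hθ.2]⟩, AddCircle.coe_add, AddCircle.coe_period, add_zero]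
  · rw [Complex.arg_mul_cos_add_sin_mul_I hr ⟨hθ.1, by linarith [hθ.2]⟩]

lemma segmentSlope_mem {p q : ℝ × ℝ} (hpq : p ≠ q) (h : IsDirection (q - p)) :
    segmentSlope (toComplex p) (toComplex q) ∈
      ({((0 : ℝ) : AddCircle Real.pi), ((Real.pi / 4 : ℝ) : AddCircle Real.pi),
        ((-(Real.pi / 4) : ℝ) : AddCircle Real.pi)} : Set (AddCircle Real.pi)) := by
  have hpi := Real.pi_pos
  have hne : q - p ≠ 0 := sub_ne_zero.2 hpq.symm
  rw [segmentSlope, ← map_sub]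
  generalize q - p = d at h hne
  obtain ⟨x, y⟩ := d
  have hsq : √2 * (√2 / 2) = 1 := by
    rw [← mul_div_assoc, Real.mul_self_sqrt (by norm_num)]; norm_num
  have h2 : (√2 : ℝ) ≠ 0 := by positivity
  rcases h with h | h | h <;> dsimp only at h
  · subst h
    have hy : y ≠ 0 := by rintro rfl; exact hne rfl
    right; right
    rw [mem_singleton_iff, ← arg_real_mul_cos_add_sin (r := -y * √2)
      (mul_ne_zero (neg_ne_zero.2 hy) h2) (θ := -(Real.pi / 4)) ⟨by linarith, by linarith⟩]
    congr 2
    rw [← Complex.ofReal_cos, ← Complex.ofReal_sin, Real.cos_neg, Real.sin_neg, Real.cos_pi_div_four,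
      Real.sin_pi_div_four, toComplex_apply]
    apply Complex.ext
    · simp; linear_combination -y * hsq
    · simp; linear_combination -y * hsq
  · subst h
    have hx : x ≠ 0 := by rintro rfl; exact hne rfl
    right; left
    -- The representative -3π/4 of this slope lies in the interval (-π, 0] required by
    -- `arg_real_mul_cos_add_sin`.
    have hθ : ((Real.pi / 4 : ℝ) : AddCircle Real.pi) =
        ((-(3 * Real.pi / 4) : ℝ) : AddCircle Real.pi) := by
      rw [← AddCircle.coe_add_period Real.pi (-(3 * Real.pi / 4))]
      congr 1
      ring
    rw [hθ, ← arg_real_mul_cos_add_sin (r := -x * √2)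
      (mul_ne_zero (neg_ne_zero.2 hx) h2) (θ := -(3 * Real.pi / 4)) ⟨by linarith, by linarith⟩]
    congr 2
    rw [← Complex.ofReal_cos, ← Complex.ofReal_sin,
      show -(3 * Real.pi / 4) = Real.pi / 4 - Real.pi by ring, Real.cos_sub_pi, Real.sin_sub_pi,
      Real.cos_pi_div_four, Real.sin_pi_div_four, toComplex_apply]
    apply Complex.ext
    · simp; linear_combination -x * hsq
    · simp; linear_combination -x * hsq
  · obtain rfl : y = -x := by linarith
    have hx : x ≠ 0 := by rintro rfl; exact hne (by simp)
    left
    rw [← arg_real_mul_cos_add_sin (r := 2 * x)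
      (mul_ne_zero two_ne_zero hx) (θ := 0) ⟨by linarith, le_rfl⟩]
    congr 2
    rw [toComplex_apply]
    apply Complex.ext
    · simp; ring
    · simp

/-- A drawing with three directions, in the plane of complex numbers. -/
lemma IsDrawing.toComplex {V : Type u} {E : SimpleGraph V} {R : Set (ℝ × ℝ)} {φ : V → ℝ × ℝ}
    (h : IsDrawing E univ R φ) :
    IsStraightLineEmbedding E (SeriesParallelDrawing.toComplex ∘ φ) where
  injective := toComplex_injective.comp (injOn_univ.1 h.injOn)
  vertex_edge := fun u v w huv hw => by
    rw [Function.comp_apply, Function.comp_apply, ← image_segment_toComplex] at hw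
    exact h.vertex_edge u v w huv (mem_univ w) (toComplex_injective.mem_set_image.1 hw)
  edge_edge := fun u v x y huv hxy hne z hz => by
    simp only [Function.comp_apply, ← image_segment_toComplex] at hz
    obtain ⟨⟨z, hz, rfl⟩, hz'⟩ := hz
    obtain ⟨w, h₁, h₂, rfl⟩ := h.edge_edge u v x y huv hxy hne z hz
      (toComplex_injective.mem_set_image.1 hz')
    exact ⟨w, ⟨h₁, h₂⟩, rfl⟩

end SeriesParallelDrawing

open SeriesParallelDrawing in
theorem theorem2 (G : TwoTerminalGraph.{u}) [Fintype G.V] [DecidableRel G.graph.Adj]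
    (hG : G.IsSeriesParallel) (hdeg : G.graph.maxDegree ≤ 3) :
    planarSlopeNumber G.graph ≤ 3 ∧
    ∃ φ : G.V → ℂ, IsStraightLineEmbedding G.graph φ ∧
      edgeSlopes G.graph φ ⊆
        {((0 : ℝ) : AddCircle Real.pi), ((Real.pi / 4 : ℝ) : AddCircle Real.pi),
          ((-(Real.pi / 4) : ℝ) : AddCircle Real.pi)} := by
  have hdeg' : ∀ v, (G.graph.neighborSet v).encard ≤ 3 := by
    intro v
    rw [← SimpleGraph.coe_neighborFinset, Set.encard_coe_eq_coe_finsetCard,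
      SimpleGraph.card_neighborFinset_eq_degree]
    exact_mod_cast (G.graph.degree_le_maxDegree v).trans hdeg
  obtain ⟨k, m, n, h, hm, hn⟩ := (composed_of_isSeriesParallel hG).exists_sp hdeg'
  obtain ⟨R, p, q, φ, hφ, -⟩ := h.exists_drawable
    (by exact_mod_cast hm.trans (hdeg' _)) (by exact_mod_cast hn.trans (hdeg' _))
  have hslopes : edgeSlopes G.graph (toComplex ∘ φ) ⊆
      {((0 : ℝ) : AddCircle Real.pi), ((Real.pi / 4 : ℝ) : AddCircle Real.pi),
        ((-(Real.pi / 4) : ℝ) : AddCircle Real.pi)} := by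
    rintro _ ⟨u, v, huv, rfl⟩
    exact segmentSlope_mem (fun h => huv.ne (hφ.injOn trivial trivial h)) (hφ.isDirection u v huv)
  refine ⟨?_, _, hφ.toComplex, hslopes⟩
  refine (iInf₂_le _ hφ.toComplex).trans ((Set.encard_le_encard hslopes).trans ?_)
  refine (Set.encard_insert_le _ _).trans ?_
  refine (add_le_add_left (Set.encard_insert_le _ _) 1).trans ?_
  rw [Set.encard_singleton]
  norm_num
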